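/- Let $0<\omega_1<\omega_2$ and $\alpha>0$. Let $\mathbb S\subset\mathbb R^2$ be the unit circle with arc length measure, $\mathcal B_R\subset\mathbb R^2$ the ball of radius $R>0$ about the origin, and $c_\omega=e^{i\pi/4}\omega^2/\sqrt{8\pi\omega}$. Put $a_1(\hat x,\zeta)=-\hat x\cdot\zeta$, $a_2=1$, and let $$F:(L^2(\mathcal B_R))^2\to (L^2(\mathbb S\times\mathbb S))^2,\qquad (F\mathbf f)_i(\hat x,\zeta)=\sum_{j=1}^2 c_{\omega_i}\,a_j(\hat x,\zeta)\int_{\mathcal B_R}e^{i\omega_i(\zeta-\hat x)\cdot y}f_j(y)\,dy ,\quad i=1,2,$$ with Hilbert space adjoint $F^*$. Pairs in $(L^2(\mathcal B_R))^2$ are extended by zero to $\mathbb R^2$ where needed. Then $F^*$ is given on $\mathcal B_R$ by $$(F^*\Lambda)_j(y)=\sum_{i=1}^2\overline{c_{\omega_i}}\int_{\mathbb S\times\mathbb S}a_j(\hat x,\zeta)e^{i\omega_i(\hat x-\zeta)\cdot y}\Lambda_i(\hat x,\zeta)\,d\hat x\,d\zeta ,$$ and the right-hand side makes sense for all $y\in\mathbb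 R^2$. For $\mathbf f\in (L^2(\mathcal B_R))^2$ let $\mathbf h=(F^*F+\alpha I)\mathbf f$ denote the function on all of $\mathbb R^2$ obtained from this formula; on $\mathcal B_R$ it agrees a.e. with the Hilbert space operator $F^*F+\alpha I$ applied to $\mathbf f$. For $j,j'\in\{1,2\}$ define the real-valued filters $$g_{jj'}^{\omega}(y)=(-1)^{j+j'}|c_\omega|^2\int_{\mathbb S\times\mathbb S}(\hat x\cdot\zeta)^{4-j-j'}\cos(\omega(\hat x-\zeta)\cdot y)\,d\hat x\,d\zeta ,$$ and the matrix kernel of tempered distributions $$\mathbf g=\sum_{i=1}^2\begin{bmatrix} g_{11}^{\omega_i}+\frac\alpha2\delta & g_{12}^{\omega_i}\\ g_{21}^{\omega_i}& g_{22}^{\omega_i}+\frac\alpha2\delta\end{bmatrix}.$$ Let $\mathcal F$ be the entrywise Fourier transform of tempered distributions, with $\mathcal F\varphi(\xi)=\int e^{-2\pi i x\cdot\xi}\varphi(x)\,dx$. A sum of convolutions $\sum_k T_k*U_k$ of tempered distributions whose Fourier transforms are functions means the tempered distribution $V$ with $\mathcal F V=\sum_k\mathcal F T_k\cdot\mathcal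 F U_k$, provided that this function is integrable against every Schwartz function (the single products need not be). Then the following holds. 1. Each $g_{jj'}^{\omega_i}$ is radially symmetric. 2. $\mathcal F(\mathbf g)$ is a real symmetric matrix-valued function, and $\det\mathcal F(\mathbf g)\ge\alpha^2$ a.e. 3. The matrix kernel $\mathbf K:=\mathcal F^{-1}(\mathcal F(\mathbf g)^{-1})$ of tempered distributions is well defined. So are the tempered distributions $$g_{de}=\sum_{i,i'=1}^2\Big(\big(g_{11}^{\omega_i}+\tfrac\alpha2\delta\big)*\big(g_{22}^{\omega_{i'}}+\tfrac\alpha2\delta\big)-g_{12}^{\omega_i}*g_{12}^{\omega_{i'}}\Big),\qquad g_2=\mathcal F^{-1}\big(\det(\mathcal F(\mathbf g))^{-1}\big).$$ Moreover $\mathcal F(g_{de})=\det\mathcal F(\mathbf g)$, so that $g_2=\mathcal F^{-1}(\mathcal F(g_{de})^{-1})$ and $g_2*g_{de}=\delta$, and $$\mathbf K=(g_2I_2)*\sum_{i=1}^2\begin{bmatrix} g_{22}^{\omega_i}+\frac\alpha2\delta & -g_{12}^{\omega_i}\\ -g_{21}^{\omega_i}& g_{11}^{\omega_i}+\frac\alpha2\delta\end{bmatrix}.$$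 4. For every $R>0$ the operator $F^*F+\alpha I$ is invertible on $(L^2(\mathcal B_R))^2$. For every $\mathbf f\in(L^2(\mathcal B_R))^2$, with $\mathbf h=(F^*F+\alpha I)\mathbf f$ on $\mathbb R^2$ as above, one has on the whole plane $$\mathbf h=\mathbf g*\mathbf f\qquad\text{and}\qquad (F^*F+\alpha I)^{-1}(\mathbf h|_{\mathcal B_R})=\mathbf K*\mathbf h ,$$ where the left-hand side of the second identity is extended by zero to $\mathbb R^2$. The first identity holds both pointwise, as the integrals $\int_{\mathbb R^2} g_{jj'}^{\omega_i}(y-z)f_{j'}(z)\,dz$ plus $\alpha f_j(y)$, and in the sense of tempered distributions. 5. The map $\mathbf f\mapsto\mathbf h$ and its inverse are translation invariant: if $\mathbf f_1,\mathbf f_2\in(L^2(\mathcal B_R))^2$ give $\mathbf h_1,\mathbf h_2$, and $a\in\mathbb R^2$, then $\mathbf f_2=\mathbf f_1(\cdot-a)$ a.e. on $\mathbb R^2$ if and only if $\mathbf h_2=\mathbf h_1(\cdot-a)$ a.e. on $\mathbb R^2$. -/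

import Mathlib

open MeasureTheory SchwartzMap
open scoped FourierTransform ENNReal

noncomputable section

/-- The Euclidean plane `ℝ²`. -/
abbrev Plane : Type := EuclideanSpace ℝ (Fin 2)

/-- The unit circle `𝕊`. -/
abbrev Circ : Type := Metric.sphere (0 : Plane) 1

/-- The product of two copies of the arc length measure, on the pairs `(x̂, ζ)` of `𝕊 × 𝕊`. -/
abbrev circSq : Measure (Circ × Circ) :=
  (volume : Measure Plane).toSphere.prod (volume : Measure Plane).toSphere

/-- Lebesgue measure on the ball `𝓑_R` about the origin. -/
abbrev ballMeasure (R : ℝ) : Measure Plane := volume.restrict (Metric.ball 0 R)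

/-- `L²(𝓑_R)`. -/
abbrev L2Ball (R : ℝ) : Type := Lp ℂ 2 (ballMeasure R)

/-- `L²(𝕊 × 𝕊)`. -/
abbrev L2Data : Type := Lp ℂ 2 circSq

/-- `(L²(𝓑_R))²`, as a Hilbert space. -/
abbrev L2BallPair (R : ℝ) : Type := PiLp 2 (fun _ : Fin 2 => L2Ball R)

/-- `(L²(𝕊 × 𝕊))²`, as a Hilbert space. -/
abbrev L2DataPair : Type := PiLp 2 (fun _ : Fin 2 => L2Data)

/-- `c_ω = e^{iπ/4} ω² / √(8πω)`. -/
def cOmega (ω : ℝ) : ℂ :=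
  Complex.exp (Complex.I * (Real.pi / 4)) * (ω ^ 2 : ℝ) / (Real.sqrt (8 * Real.pi * ω) : ℝ)

/-- The inner product `x̂ · ζ`. -/
def dirDot (p : Circ × Circ) : ℝ := inner ℝ (p.1 : Plane) (p.2 : Plane)

/-- The angular factor of the two unknowns: `-(x̂ · ζ)` for `γ` (index `0`), `1` for `η`
(index `1`). -/
def angular (j : Fin 2) (p : Circ × Circ) : ℝ := ![-dirDot p, 1] j

/-- The phase `(x̂ - ζ) · y`. -/
def phase (p : Circ × Circ) (y : Plane) : ℝ := inner ℝ ((p.1 : Plane) - (p.2 : Plane)) y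

lemma continuous_dirDot : Continuous dirDot := by
  unfold dirDot; fun_prop

lemma abs_dirDot_le (p : Circ × Circ) : |dirDot p| ≤ 1 := by
  have h := abs_real_inner_le_norm (p.1 : Plane) (p.2 : Plane)
  have h1 : ‖(p.1 : Plane)‖ = 1 := by simp
  have h2 : ‖(p.2 : Plane)‖ = 1 := by simp
  simpa [dirDot, h1, h2] using h

lemma continuous_angular (j : Fin 2) : Continuous (angular j) := by
  have := continuous_dirDot
  fin_cases j
  · show Continuous fun p => -dirDot p
    fun_prop
  · show Continuous fun _ => (1 : ℝ)
    fun_prop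

lemma abs_angular_le (j : Fin 2) (p : Circ × Circ) : |angular j p| ≤ 1 := by
  fin_cases j
  · simpa [angular] using abs_dirDot_le p
  · simp [angular]

lemma continuous_phase : Continuous fun q : (Circ × Circ) × Plane => phase q.1 q.2 := by
  unfold phase; fun_prop

/-- The Fourier kernel `c_ω · a_j(x̂, ζ) · e^{iω(ζ - x̂)·y}` with the angular factor `a_j`. -/
def fwdKernel (ω : ℝ) (j : Fin 2) (p : Circ × Circ) (y : Plane) : ℂ :=
  cOmega ω * (angular j p : ℂ) * Complex.exp (-(Complex.I * ((ω * phase p y : ℝ) : ℂ)))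

lemma continuous_fwdKernel (ω : ℝ) (j : Fin 2) :
    Continuous fun q : (Circ × Circ) × Plane => fwdKernel ω j q.1 q.2 := by
  have h1 := continuous_phase
  have h2 := continuous_angular j
  unfold fwdKernel
  fun_prop

lemma norm_fwdKernel_le (ω : ℝ) (j : Fin 2) (p : Circ × Circ) (y : Plane) :
    ‖fwdKernel ω j p y‖ ≤ ‖cOmega ω‖ := by
  have h : ‖Complex.exp (-(Complex.I * ((ω * phase p y : ℝ) : ℂ)))‖ = 1 := by
    rw [Complex.norm_exp]; simp
  rw [fwdKernel, norm_mul, norm_mul, h, mul_one, Complex.norm_real, Real.norm_eq_abs]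
  exact mul_le_of_le_one_right (norm_nonneg _) (abs_angular_le j p)

instance isFiniteMeasure_ballMeasure (R : ℝ) : IsFiniteMeasure (ballMeasure R) :=
  ⟨by
    rw [Measure.restrict_apply_univ]
    exact measure_ball_lt_top⟩

lemma integrable_L2Ball {R : ℝ} (f : L2Ball R) : Integrable f (ballMeasure R) :=
  (Lp.memLp f).integrable (by norm_num)

lemma integrable_fwdKernel_mul (ω : ℝ) (j : Fin 2) {R : ℝ} (f : L2Ball R) (p : Circ × Circ) :
    Integrable (fun y => fwdKernel ω j p y * f y) (ballMeasure R) := by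
  refine (integrable_L2Ball f).bdd_mul (c := ‖cOmega ω‖) ?_ ?_
  · exact ((continuous_fwdKernel ω j).comp
      (by fun_prop : Continuous fun y : Plane => (p, y))).aestronglyMeasurable
  · exact Filter.Eventually.of_forall fun y => norm_fwdKernel_le ω j p y

/-- The function `(x̂, ζ) ↦ c_ω ∫_{𝓑_R} a_j(x̂, ζ) e^{iω(ζ - x̂)·y} f(y) dy`. -/
def fwdFun (ω : ℝ) (j : Fin 2) {R : ℝ} (f : L2Ball R) : C(Circ × Circ, ℂ) where
  toFun p := ∫ y in Metric.ball (0 : Plane) R, fwdKernel ω j p y * f y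
  continuous_toFun := by
    refine continuous_of_dominated (bound := fun y => ‖cOmega ω‖ * ‖f y‖) ?_ ?_ ?_ ?_
    · exact fun p => (integrable_fwdKernel_mul ω j f p).aestronglyMeasurable
    · intro p
      refine Filter.Eventually.of_forall fun y => ?_
      rw [norm_mul]
      exact mul_le_mul_of_nonneg_right (norm_fwdKernel_le ω j p y) (norm_nonneg _)
    · exact (integrable_L2Ball f).norm.const_mul _
    · refine Filter.Eventually.of_forall fun y => ?_
      have := (continuous_fwdKernel ω j).comp
        (by fun_prop : Continuous fun p : Circ × Circ => (p, y))
      exact this.mul continuous_const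

lemma integral_norm_L2Ball_le {R : ℝ} (f : L2Ball R) :
    ∫ y, ‖f y‖ ∂(ballMeasure R) ≤
      ((ballMeasure R Set.univ) ^ ((1 : ℝ) / 2)).toReal * ‖f‖ := by
  have h := eLpNorm_le_eLpNorm_mul_rpow_measure_univ (p := 1) (q := 2) (by norm_num)
    (Lp.memLp f).aestronglyMeasurable
  have hfin : (ballMeasure R Set.univ) ^ ((1 : ℝ) / 2) ≠ ∞ :=
    ENNReal.rpow_ne_top_of_nonneg (by norm_num) (measure_ne_top _ _)
  have h2 : (eLpNorm f 2 (ballMeasure R)) ≠ ∞ := (Lp.memLp f).eLpNorm_ne_top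
  rw [integral_norm_eq_lintegral_enorm (Lp.memLp f).aestronglyMeasurable,
    ← eLpNorm_one_eq_lintegral_enorm, Lp.norm_def, mul_comm, ← ENNReal.toReal_mul]
  refine ENNReal.toReal_mono (ENNReal.mul_ne_top h2 hfin) ?_
  convert h using 3
  norm_num

/-- The operator `c_ω F_j^ω : L²(𝓑_R) → L²(𝕊 × 𝕊)`. -/
def fwdOp (ω : ℝ) (j : Fin 2) (R : ℝ) : L2Ball R →L[ℂ] L2Data :=
  (ContinuousMap.toLp (E := ℂ) 2 circSq ℂ : C(Circ × Circ, ℂ) →L[ℂ] L2Data) ∘L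
    LinearMap.mkContinuous (σ := RingHom.id ℂ) (E := L2Ball R) (F := C(Circ × Circ, ℂ))
      { toFun := fun f => fwdFun ω j f
        map_add' := fun f g => by
          ext p
          have h : (fun y => fwdKernel ω j p y * (f + g : L2Ball R) y) =ᵐ[ballMeasure R]
              fun y => fwdKernel ω j p y * f y + fwdKernel ω j p y * g y := by
            filter_upwards [Lp.coeFn_add f g] with y hy
            rw [hy, Pi.add_apply, mul_add]
          show ∫ y, fwdKernel ω j p y * (f + g : L2Ball R) y ∂(ballMeasure R) =
            ∫ y, fwdKernel ω j p y * f y ∂(ballMeasure R) +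
              ∫ y, fwdKernel ω j p y * g y ∂(ballMeasure R)
          rw [integral_congr_ae h, integral_add (integrable_fwdKernel_mul ω j f p)
            (integrable_fwdKernel_mul ω j g p)]
        map_smul' := fun c f => by
          ext p
          have h : (fun y => fwdKernel ω j p y * (c • f : L2Ball R) y) =ᵐ[ballMeasure R]
              fun y => c * (fwdKernel ω j p y * f y) := by
            filter_upwards [Lp.coeFn_smul c f] with y hy
            rw [hy, Pi.smul_apply, smul_eq_mul]; ring
          show ∫ y, fwdKernel ω j p y * (c • f : L2Ball R) y ∂(ballMeasure R) =
            c * ∫ y, fwdKernel ω j p y * f y ∂(ballMeasure R)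
          rw [integral_congr_ae h, integral_const_mul] }
      (‖cOmega ω‖ * ((ballMeasure R Set.univ) ^ ((1 : ℝ) / 2)).toReal)
      (fun f => by
        refine (ContinuousMap.norm_le _ (by positivity)).2 fun p => ?_
        calc ‖∫ y, fwdKernel ω j p y * f y ∂(ballMeasure R)‖
            ≤ ∫ y, ‖cOmega ω‖ * ‖f y‖ ∂(ballMeasure R) := by
              refine norm_integral_le_of_norm_le ((integrable_L2Ball f).norm.const_mul _) ?_
              refine Filter.Eventually.of_forall fun y => ?_
              rw [norm_mul]
              exact mul_le_mul_of_nonneg_right (norm_fwdKernel_le ω j p y) (norm_nonneg _)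
          _ = ‖cOmega ω‖ * ∫ y, ‖f y‖ ∂(ballMeasure R) := integral_const_mul _ _
          _ ≤ _ := by
              rw [mul_assoc]
              exact mul_le_mul_of_nonneg_left (integral_norm_L2Ball_le f) (norm_nonneg _))

/-- The linearized forward operator `F : (L²(𝓑_R))² → (L²(𝕊 × 𝕊))²`, the `2 × 2` operator matrix
with rows indexed by the frequencies `ω 0`, `ω 1` and columns by the unknowns `γ`, `η`. -/
def forwardOp (ω : Fin 2 → ℝ) (R : ℝ) : L2BallPair R →L[ℂ] L2DataPair :=
  ((PiLp.continuousLinearEquiv 2 ℂ (fun _ : Fin 2 => L2Data)).symm :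
      (Fin 2 → L2Data) →L[ℂ] L2DataPair) ∘L
    ContinuousLinearMap.pi fun i =>
      ∑ j, fwdOp (ω i) j R ∘L PiLp.proj 2 (fun _ : Fin 2 => L2Ball R) j

/-- `F*F + αI` on the Hilbert space `(L²(𝓑_R))²`. -/
def normalOp (ω : Fin 2 → ℝ) (α R : ℝ) : L2BallPair R →L[ℂ] L2BallPair R :=
  ContinuousLinearMap.adjoint (forwardOp ω R) ∘L forwardOp ω R +
    (α : ℂ) • ContinuousLinearMap.id ℂ (L2BallPair R)

/-- The extension by zero of a pair in `(L²(𝓑_R))²` to the plane. -/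
def zeroExt {R : ℝ} (f : L2BallPair R) (j : Fin 2) : Plane → ℂ :=
  (Metric.ball (0 : Plane) R).indicator (f j)

/-- The explicit formula for the adjoint, evaluated at every point `y` of the plane:
`∑_i conj(c_{ω_i}) ∫_{𝕊×𝕊} a_j(x̂, ζ) e^{iω_i(x̂ - ζ)·y} Λ_i(x̂, ζ) dx̂ dζ`. -/
def adjointFormula (ω : Fin 2 → ℝ) (Λ : L2DataPair) (j : Fin 2) (y : Plane) : ℂ :=
  ∑ i, starRingEnd ℂ (cOmega (ω i)) *
    ∫ p, (angular j p : ℂ) * Complex.exp (Complex.I * ((ω i * phase p y : ℝ) : ℂ)) * Λ i p ∂circSq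

/-- `(F*F + αI) f` as a pair of functions on the whole plane, with `F*` given by its explicit
formula and `f` extended by zero. -/
def normalPlane (ω : Fin 2 → ℝ) (α : ℝ) {R : ℝ} (f : L2BallPair R) (j : Fin 2) (y : Plane) : ℂ :=
  adjointFormula ω (forwardOp ω R f) j y + (α : ℂ) * zeroExt f j y

/-- The filter `g_{jj'}^ω(y) = (-1)^{j+j'} |c_ω|² ∫_{𝕊×𝕊} (x̂·ζ)^{4-j-j'} cos(ω(x̂-ζ)·y) dx̂ dζ`,
`j, j' ∈ {1, 2}`; the indices `0, 1` of `Fin 2` stand for `1, 2`. -/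
def gFilter (ω : ℝ) (j j' : Fin 2) (y : Plane) : ℝ :=
  (-1) ^ ((j : ℕ) + (j' : ℕ)) * ‖cOmega ω‖ ^ 2 *
    ∫ p, dirDot p ^ (4 - ((j : ℕ) + 1) - ((j' : ℕ) + 1)) * Real.cos (ω * phase p y) ∂circSq

lemma norm_gFilter_integrand_le (ω : ℝ) (n : ℕ) (p : Circ × Circ) (y : Plane) :
    ‖dirDot p ^ n * Real.cos (ω * phase p y)‖ ≤ 1 := by
  rw [norm_mul, norm_pow]
  exact mul_le_one₀ (pow_le_one₀ (norm_nonneg _) (abs_dirDot_le p)) (norm_nonneg _)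
    (Real.abs_cos_le_one _)

lemma continuous_gFilter (ω : ℝ) (j j' : Fin 2) : Continuous (gFilter ω j j') := by
  have h1 := continuous_phase
  have h2 := continuous_dirDot
  refine continuous_const.mul (continuous_of_dominated (bound := fun _ => 1) ?_ ?_ ?_ ?_)
  · intro y
    have : Continuous fun p : Circ × Circ => phase p y :=
      h1.comp (by fun_prop : Continuous fun p : Circ × Circ => (p, y))
    exact Continuous.aestronglyMeasurable (by fun_prop)
  · exact fun y => Filter.Eventually.of_forall fun p => norm_gFilter_integrand_le ω _ p y
  · exact integrable_const _
  · refine Filter.Eventually.of_forall fun p => ?_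
    have : Continuous fun y : Plane => phase p y :=
      h1.comp (by fun_prop : Continuous fun y : Plane => (p, y))
    fun_prop

lemma memLp_gFilter (ω : ℝ) (j j' : Fin 2) :
    MemLp (fun y => (gFilter ω j j' y : ℂ)) ∞ (volume : Measure Plane) := by
  refine memLp_top_of_bound
    (Complex.continuous_ofReal.comp (continuous_gFilter ω j j')).aestronglyMeasurable
    (|(-1) ^ ((j : ℕ) + (j' : ℕ)) * ‖cOmega ω‖ ^ 2| * (1 * circSq.real Set.univ))
    (Filter.Eventually.of_forall fun y => ?_)
  rw [Complex.norm_real, gFilter, norm_mul, Real.norm_eq_abs]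
  refine mul_le_mul_of_nonneg_left ?_ (abs_nonneg _)
  exact norm_integral_le_of_norm_le_const
    (Filter.Eventually.of_forall fun p => norm_gFilter_integrand_le ω _ p y)

/-- The tempered distribution given by the bounded function `g_{jj'}^ω`. -/
def gDist (ω : ℝ) (j j' : Fin 2) : 𝓢'(Plane, ℂ) :=
  Lp.toTemperedDistribution ((memLp_gFilter ω j j').toLp _)

/-- The Dirac distribution `δ` at the origin. -/
abbrev diracZero : 𝓢'(Plane, ℂ) := TemperedDistribution.delta 0

/-- The entry `g_{jj'}^ω + (α/2) δ` (for `j = j'`) or `g_{jj'}^ω` (for `j ≠ j'`). -/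
def gEntry (ω α : ℝ) (j j' : Fin 2) : 𝓢'(Plane, ℂ) :=
  gDist ω j j' + if j = j' then ((α / 2 : ℝ) : ℂ) • diracZero else 0

/-- The matrix kernel `𝐠`. -/
def gKernel (ω : Fin 2 → ℝ) (α : ℝ) (j j' : Fin 2) : 𝓢'(Plane, ℂ) :=
  ∑ i, gEntry (ω i) α j j'

/-- The adjugate kernel
`∑_i [[g₂₂^{ω_i} + (α/2) δ, -g₁₂^{ω_i}], [-g₂₁^{ω_i}, g₁₁^{ω_i} + (α/2) δ]]`. -/
def gAdj (ω : Fin 2 → ℝ) (α : ℝ) (j j' : Fin 2) : 𝓢'(Plane, ℂ) :=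
  ∑ i, !![gEntry (ω i) α 1 1, -gEntry (ω i) α 0 1; -gEntry (ω i) α 1 0, gEntry (ω i) α 0 0] j j'

/-- The tempered distribution `T` is the function `a`. -/
def IsFunction (T : 𝓢'(Plane, ℂ)) (a : Plane → ℂ) : Prop :=
  ∀ φ : 𝓢(Plane, ℂ), Integrable (fun x => φ x * a x) ∧ T φ = ∫ x, φ x * a x

/-- The Fourier transform of `T` is the function `a`. -/
def HasFourier (T : 𝓢'(Plane, ℂ)) (a : Plane → ℂ) : Prop := IsFunction (𝓕 T) a

/-- `V` is the sum of convolutions `∑_k T_k * U_k` of tempered distributions whose Fourier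
transforms are functions, that is, `𝓕 V = ∑_k 𝓕 T_k · 𝓕 U_k` as functions. -/
def IsConv {κ : Type} [Fintype κ] (T U : κ → 𝓢'(Plane, ℂ)) (V : 𝓢'(Plane, ℂ)) : Prop :=
  ∃ a b : κ → Plane → ℂ, (∀ k, HasFourier (T k) (a k)) ∧ (∀ k, HasFourier (U k) (b k)) ∧
    HasFourier V (fun ξ => ∑ k, a k ξ * b k ξ)

/-- The left factors of
`∑_{i,i'} (g₁₁^{ω_i} + (α/2) δ) * (g₂₂^{ω_{i'}} + (α/2) δ) - g₁₂^{ω_i} * g₁₂^{ω_{i'}}`, indexed by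
`(i, i', 0)` and `(i, i', 1)` for the two terms. -/
def detLeft (ω : Fin 2 → ℝ) (α : ℝ) (k : Fin 2 × Fin 2 × Fin 2) : 𝓢'(Plane, ℂ) :=
  ![gEntry (ω k.1) α 0 0, -gEntry (ω k.1) α 0 1] k.2.2

/-- The corresponding right factors. -/
def detRight (ω : Fin 2 → ℝ) (α : ℝ) (k : Fin 2 × Fin 2 × Fin 2) : 𝓢'(Plane, ℂ) :=
  ![gEntry (ω k.2.1) α 1 1, gEntry (ω k.2.1) α 0 1] k.2.2

end

/-!
The argument rests on one computation: under the product of the arc length measures, the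
difference `x̂ - ζ` of two points of the unit circle has the density `4 / (|x| √(4 - |x|²))` on the
disc of radius `2` (`map_sub_circSq`). Rotation invariance reduces it to the law of the length of a
chord with one fixed endpoint, which is `2 |sin (θ / 2)|`.

Since `x̂ · ζ = 1 - |x̂ - ζ|² / 2`, the angular factors are functions of `x̂ - ζ` as well. Each filter
`g_{jj'}^ω` is a superposition of the plane waves with frequencies `ξ = ω (x̂ - ζ) / (2π)`, hence the
inverse Fourier integral of an integrable function `specWeight ω j j'`, which is a nonnegative
density times a product of the angular factors of `j` and `j'` (`gFilter_eq_fourierInv`). So `𝓕 𝐠` is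
`α I` plus two real rank one positive semidefinite matrices, its determinant is at least `α²`, and
the entries of its inverse are bounded by `1 / α`; this gives `𝐊` and `g₂`. For `g_de`, the products
of the densities are not locally integrable at the origin, but in the determinant they only occur
multiplied by the squared difference of the angular factors at the two frequencies, which is of
order `|ξ|⁴`; as the frequencies differ, the singularity on the boundary of the larger disc lies
outside the smaller one (`exists_bound_scaledDens_mul`).

The data `F 𝐟` are samples of the Fourier transform of `𝐟` at the frequencies `ξ`
(`fwdFun_eq_fourier`). Inserting them into the explicit formula for the adjoint gives the inverse
Fourier integral of `specWeight` times this Fourier transform (`adjointFormula_forwardOp`), which is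
the convolution with the filters, and so `𝓕 𝐡 = 𝓕 𝐠 · 𝓕 𝐟`. Multiplication by the inverse matrix
recovers `𝓕 𝐟`.

For the translation invariance, the difference of `𝐟₂` and the translate of `𝐟₁` is supported in a
larger ball, and it is mapped to the difference of `𝐡₂` and the translate of `𝐡₁`. The claim follows
from the injectivity of the operator `F*F + αI` on the larger ball.
-/

noncomputable section

/-! ### The arc length measure in polar coordinates -/

/-- The action of a linear isometry on the unit sphere. -/
def sphereMap (A : Plane ≃ₗᵢ[ℝ] Plane) (u : Circ) : Circ :=
  ⟨A u, by simp⟩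

lemma continuous_sphereMap (A : Plane ≃ₗᵢ[ℝ] Plane) : Continuous (sphereMap A) := by
  unfold sphereMap
  have := A.continuous
  fun_prop

open scoped Pointwise in
lemma measurePreserving_sphereMap (A : Plane ≃ₗᵢ[ℝ] Plane) :
    MeasurePreserving (sphereMap A) (volume : Measure Plane).toSphere
      (volume : Measure Plane).toSphere := by
  refine ⟨(continuous_sphereMap A).measurable, ?_⟩
  ext s hs
  rw [Measure.map_apply (continuous_sphereMap A).measurable hs, Measure.toSphere_apply' _ hs,
    Measure.toSphere_apply' _ ((continuous_sphereMap A).measurable hs)]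
  congr 1
  have h : Set.Ioo (0 : ℝ) 1 • ((↑) '' (sphereMap A ⁻¹' s) : Set Plane) =
      A ⁻¹' (Set.Ioo (0 : ℝ) 1 • ((↑) '' s : Set Plane)) := by
    ext x
    simp only [Set.mem_smul, Set.mem_image, Set.mem_preimage]
    constructor
    · rintro ⟨r, hr, _, ⟨u, hu, rfl⟩, rfl⟩
      exact ⟨r, hr, _, ⟨_, hu, rfl⟩, by simp [sphereMap]⟩
    · rintro ⟨r, hr, _, ⟨u, hu, rfl⟩, h⟩
      refine ⟨r, hr, _, ⟨sphereMap A.symm u, ?_, rfl⟩, ?_⟩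
      · simpa [sphereMap] using hu
      · apply A.injective
        simp [sphereMap, h]
  rw [h]
  exact (A.measurePreserving.measure_preimage_emb A.toHomeomorph.measurableEmbedding _)

/-- Integration in polar coordinates in the plane. -/
lemma lintegral_plane_polar {F : Plane → ℝ≥0∞} (hF : Measurable F) :
    ∫⁻ x, F x = ∫⁻ u, ∫⁻ r in Set.Ioi (0 : ℝ), ENNReal.ofReal r * F (r • (u : Plane))
      ∂volume ∂(volume : Measure Plane).toSphere := by
  have h0 : ∫⁻ x, F x =
      ∫⁻ x : ({0}ᶜ : Set Plane), F x ∂(volume.comap ((↑) : ({0}ᶜ : Set Plane) → Plane)) := by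
    rw [lintegral_subtype_comap (measurableSet_singleton _).compl, restrict_compl_singleton]
  have h1 := (volume : Measure Plane).measurePreserving_homeomorphUnitSphereProd
  have h2 : ∀ x : ({0}ᶜ : Set Plane), F x =
      (fun q : Circ × Set.Ioi (0 : ℝ) => F (q.2.1 • (q.1 : Plane)))
        (homeomorphUnitSphereProd Plane x) := by
    intro x
    have := congrArg Subtype.val ((homeomorphUnitSphereProd Plane).symm_apply_apply x)
    rw [homeomorphUnitSphereProd_symm_apply_coe] at this
    exact (congrArg F this).symm
  have hm : Measurable (fun q : Circ × Set.Ioi (0 : ℝ) => F (q.2.1 • (q.1 : Plane))) := by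
    fun_prop
  rw [h0, lintegral_congr h2, h1.lintegral_comp hm, lintegral_prod _ hm.aemeasurable]
  refine lintegral_congr fun u => ?_
  have hd : Module.finrank ℝ Plane - 1 = 1 := by simp
  rw [hd, Measure.volumeIoiPow, lintegral_withDensity_eq_lintegral_mul _ (by fun_prop) (by fun_prop)]
  simp only [Pi.mul_apply, pow_one]
  rw [lintegral_subtype_comap measurableSet_Ioi
    (fun r : ℝ => ENNReal.ofReal r * F (r • (u : Plane)))]

/-- The identification of `ℂ` with the plane. -/
abbrev toPlane : ℂ ≃ₗᵢ[ℝ] Plane := Complex.orthonormalBasisOneI.repr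

lemma lintegral_Ioo_ofReal : ∫⁻ r in Set.Ioo (0 : ℝ) 1, ENNReal.ofReal r = 2⁻¹ := by
  rw [← ofReal_integral_eq_lintegral_ofReal, ← integral_Ioc_eq_integral_Ioo,
    ← intervalIntegral.integral_of_le zero_le_one, integral_id]
  · rw [show ((1 : ℝ) ^ 2 - 0 ^ 2) / 2 = 2⁻¹ by norm_num, ENNReal.ofReal_inv_of_pos (by norm_num)]
    simp
  · exact (continuous_id.integrableOn_Icc).mono_set Set.Ioo_subset_Icc_self
  · filter_upwards [ae_restrict_mem measurableSet_Ioo] with r hr using hr.1.le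

/-- The point of the plane with polar angle `θ`. -/
def circPt (θ : ℝ) : Plane := toPlane (Complex.exp (θ * Complex.I))

lemma continuous_circPt : Continuous circPt := by
  unfold circPt
  exact toPlane.continuous.comp (by fun_prop)

lemma norm_circPt (θ : ℝ) : ‖circPt θ‖ = 1 := by
  simp [circPt, Complex.norm_exp]

/-- The arc length measure is the image of Lebesgue measure under the parametrization by the polar
angle. -/
lemma lintegral_toSphere_eq {g : Plane → ℝ≥0∞} (hg : Measurable g) :
    ∫⁻ u : Circ, g u ∂(volume : Measure Plane).toSphere =
      ∫⁻ θ in Set.Ioo (-Real.pi) Real.pi, g (circPt θ) := by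
  -- Both sides are twice the integral over the unit disc of the radially constant extension of `g`.
  set F : Plane → ℝ≥0∞ := fun x => (Metric.ball 0 1).indicator (fun x => g (‖x‖⁻¹ • x)) x with hF
  have hFm : Measurable F :=
    Measurable.indicator (by fun_prop) measurableSet_ball
  have key : ∀ v : Plane, ‖v‖ = 1 → ∀ r ∈ Set.Ioi (0 : ℝ), ENNReal.ofReal r * F (r • v) =
      (Set.Ioo (0 : ℝ) 1).indicator (fun r => ENNReal.ofReal r * g v) r := by
    intro v hv r hr
    have hr : 0 < r := hr
    have hn : ‖r • v‖ = r := by rw [norm_smul, hv, mul_one, Real.norm_of_nonneg hr.le]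
    by_cases h1 : r < 1
    · rw [Set.indicator_of_mem (show r ∈ Set.Ioo (0 : ℝ) 1 from ⟨hr, h1⟩), hF]
      simp only
      rw [Set.indicator_of_mem (by simpa [hn] using h1), hn, smul_smul, inv_mul_cancel₀ hr.ne',
        one_smul]
    · rw [Set.indicator_of_notMem (fun h => h1 h.2), hF]
      simp only
      rw [Set.indicator_of_notMem (by simpa [hn] using h1), mul_zero]
  have inner : ∀ v : Plane, ‖v‖ = 1 →
      ∫⁻ r in Set.Ioi (0 : ℝ), ENNReal.ofReal r * F (r • v) = 2⁻¹ * g v := by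
    intro v hv
    rw [setLIntegral_congr_fun measurableSet_Ioi (key v hv), setLIntegral_indicator measurableSet_Ioo,
      Set.inter_eq_left.2 (fun r hr => hr.1),
      lintegral_mul_const _ (by fun_prop), lintegral_Ioo_ofReal]
  have hA : ∫⁻ x, F x = 2⁻¹ * ∫⁻ u : Circ, g u ∂(volume : Measure Plane).toSphere := by
    rw [lintegral_plane_polar hFm, ← lintegral_const_mul _ (by fun_prop)]
    exact lintegral_congr fun u => inner u (by simp)
  have hB : ∫⁻ x, F x = 2⁻¹ * ∫⁻ θ in Set.Ioo (-Real.pi) Real.pi, g (circPt θ) := by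
    rw [← (toPlane.measurePreserving).lintegral_comp hFm, ← Complex.lintegral_comp_polarCoord_symm,
      polarCoord_target, Measure.volume_eq_prod, setLIntegral_prod_symm,
      ← lintegral_const_mul _ (show Measurable fun θ => g (circPt θ) from
        hg.comp continuous_circPt.measurable)]
    · refine lintegral_congr fun θ => ?_
      rw [← inner _ (norm_circPt θ)]
      refine lintegral_congr fun r => ?_
      simp only [smul_eq_mul, Complex.polarCoord_symm_apply]
      congr 2
      rw [circPt, ← map_smul, Complex.exp_mul_I]
      simp [mul_add]
    · refine Measurable.aemeasurable ?_
      have : (fun a : ℝ × ℝ => Complex.polarCoord.symm a) = fun a : ℝ × ℝ =>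
          (a.1 : ℂ) * (Real.cos a.2 + Real.sin a.2 * Complex.I) := by
        funext a; rw [Complex.polarCoord_symm_apply]
      have h2 : Measurable fun a : ℝ × ℝ => F (toPlane (Complex.polarCoord.symm a)) := by
        refine hFm.comp (toPlane.continuous.measurable.comp ?_)
        change Measurable fun a : ℝ × ℝ => Complex.polarCoord.symm a
        rw [this]
        fun_prop
      exact (measurable_fst.ennreal_ofReal).mul h2
  have := hA.symm.trans hB
  exact (ENNReal.mul_right_inj (by simp) (by simp)).1 this

/-! ### The law of the difference of two points of the circle -/

/-- The rotation of the plane which takes the point with polar angle zero to `u`. -/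
def rotBy (u : Circ) : Plane ≃ₗᵢ[ℝ] Plane :=
  toPlane.symm.trans ((rotation (⟨toPlane.symm u, mem_sphere_zero_iff_norm.2 <| by
    rw [LinearIsometryEquiv.norm_map, norm_eq_of_mem_sphere]⟩ : Circle)).trans toPlane)

lemma rotBy_apply (u : Circ) (v : Plane) :
    rotBy u v = toPlane (toPlane.symm u * toPlane.symm v) := rfl

lemma rotBy_comm (u v : Circ) : rotBy u v = rotBy v u := by
  rw [rotBy_apply, rotBy_apply, mul_comm]

lemma rotBy_circPt_zero (u : Circ) : rotBy u (circPt 0) = u := by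
  rw [rotBy_apply, circPt, LinearIsometryEquiv.symm_apply_apply, Complex.ofReal_zero, zero_mul,
    Complex.exp_zero, mul_one, LinearIsometryEquiv.apply_symm_apply]

lemma norm_circPt_sub_circPt_zero (θ : ℝ) : ‖circPt θ - circPt 0‖ = 2 * |Real.sin (θ / 2)| := by
  rw [circPt, circPt, ← map_sub, LinearIsometryEquiv.norm_map, mul_comm]
  simp only [Complex.ofReal_zero, zero_mul, Complex.exp_zero]
  rw [Complex.norm_exp_I_mul_ofReal_sub_one]
  simp

/-- By rotation invariance, the law of `x̂ - ζ` is radial, and the law of its norm can be computed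
with `ζ` fixed. -/
lemma lintegral_sub_eq_lintegral_norm {F : Plane → ℝ≥0∞} (hF : Measurable F) :
    ∫⁻ z : Circ, ∫⁻ x : Circ, F ((x : Plane) - z) ∂(volume : Measure Plane).toSphere
        ∂(volume : Measure Plane).toSphere =
      ∫⁻ w : Circ, ∫⁻ z : Circ, F (‖(w : Plane) - circPt 0‖ • (z : Plane))
        ∂(volume : Measure Plane).toSphere ∂(volume : Measure Plane).toSphere := by
  -- Write `x̂` as the rotation of `w` by `ζ`, so that `x̂ - ζ` is the rotation of `w - 1` by `ζ`.
  have h1 : ∀ z : Circ, ∫⁻ x : Circ, F ((x : Plane) - z) ∂(volume : Measure Plane).toSphere =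
      ∫⁻ w : Circ, F (rotBy z ((w : Plane) - circPt 0)) ∂(volume : Measure Plane).toSphere := by
    intro z
    rw [← (measurePreserving_sphereMap (rotBy z)).lintegral_comp
      (show Measurable fun x : Circ => F ((x : Plane) - z) by fun_prop)]
    refine lintegral_congr fun w => ?_
    rw [map_sub, rotBy_circPt_zero]
    rfl
  rw [lintegral_congr h1, lintegral_lintegral_swap]
  · refine lintegral_congr fun w => ?_
    -- For fixed `v = w - 1`, the rotation of `v` by `ζ` is `|v|` times the rotation of `ζ` by
    -- `v / |v|`.
    generalize (w : Plane) - circPt 0 = v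
    by_cases hv : v = 0
    · simp [hv]
    · have hn : ‖v‖ ≠ 0 := norm_ne_zero_iff.2 hv
      let t : Circ := ⟨‖v‖⁻¹ • v, by simp [norm_smul, hn]⟩
      have ht : v = ‖v‖ • (t : Plane) := by simp [t, smul_smul, hn]
      rw [← (measurePreserving_sphereMap (rotBy t)).lintegral_comp
        (show Measurable fun z : Circ => F (‖v‖ • (z : Plane)) by fun_prop)]
      refine lintegral_congr fun z => ?_
      conv_lhs => rw [ht, map_smul, rotBy_comm]
      rfl
  · refine Measurable.aemeasurable ?_
    simp only [Function.uncurry_def, rotBy_apply]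
    refine hF.comp (Continuous.measurable ?_)
    have := toPlane.continuous
    have := toPlane.symm.continuous
    fun_prop

/-- The substitution `r = 2 sin (θ / 2)`. -/
lemma lintegral_two_mul_sin (H : ℝ → ℝ≥0∞) :
    ∫⁻ θ in Set.Ioo (-Real.pi) Real.pi, H (2 * |Real.sin (θ / 2)|) =
      ∫⁻ r in Set.Ioi (0 : ℝ), ENNReal.ofReal (4 / √(4 - r ^ 2)) * H r := by
  have hpi := Real.pi_pos
  have hsplit : Set.Ioo (-Real.pi) Real.pi =ᵐ[volume]
      (Set.Ioo (-Real.pi) 0 ∪ Set.Ioo 0 Real.pi : Set ℝ) := by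
    have : Set.Ioo (-Real.pi) Real.pi = Set.Ioc (-Real.pi) 0 ∪ Set.Ioo 0 Real.pi :=
      (Set.Ioc_union_Ioo_eq_Ioo (by linarith) hpi).symm
    rw [this]
    exact (Ioo_ae_eq_Ioc.symm).union Filter.EventuallyEq.rfl
  have hneg : ∫⁻ θ in Set.Ioo (-Real.pi) 0, H (2 * |Real.sin (θ / 2)|) =
      ∫⁻ θ in Set.Ioo 0 Real.pi, H (2 * |Real.sin (θ / 2)|) := by
    rw [← (Measure.measurePreserving_neg (volume : Measure ℝ)).setLIntegral_comp_preimage_emb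
      (MeasurableEquiv.neg ℝ).measurableEmbedding]
    simp [neg_div, Real.sin_neg]
  have himage : (fun θ : ℝ => 2 * Real.sin (θ / 2)) '' Set.Ioo 0 Real.pi = Set.Ioo 0 2 := by
    ext r
    constructor
    · rintro ⟨θ, hθ, rfl⟩
      have h1 : 0 < Real.sin (θ / 2) :=
        Real.sin_pos_of_pos_of_lt_pi (by linarith [hθ.1]) (by linarith [hθ.2])
      have h2 : Real.sin (θ / 2) < Real.sin (Real.pi / 2) :=
        Real.sin_lt_sin_of_lt_of_le_pi_div_two (by linarith [hθ.1]) le_rfl (by linarith [hθ.2])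
      rw [Real.sin_pi_div_two] at h2
      constructor <;> simp only <;> linarith
    · rintro ⟨h0, h2⟩
      refine ⟨2 * Real.arcsin (r / 2), ⟨?_, ?_⟩, ?_⟩
      · have : 0 < Real.arcsin (r / 2) := Real.arcsin_pos.2 (by linarith)
        linarith
      · have : Real.arcsin (r / 2) < Real.pi / 2 := Real.arcsin_lt_pi_div_two.2 (by linarith)
        linarith
      · simp only
        rw [mul_div_cancel_left₀ _ (two_ne_zero), Real.sin_arcsin (by linarith) (by linarith)]
        ring
  have hinj : Set.InjOn (fun θ : ℝ => 2 * Real.sin (θ / 2)) (Set.Ioo 0 Real.pi) := by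
    intro a ha b hb hab
    have := Real.injOn_sin (x₁ := a / 2) (x₂ := b / 2)
      ⟨by linarith [ha.1], by linarith [ha.2]⟩ ⟨by linarith [hb.1], by linarith [hb.2]⟩
      (by simpa only [mul_right_inj' (two_ne_zero' ℝ)] using hab)
    linarith
  have hderiv : ∀ θ ∈ Set.Ioo 0 Real.pi, HasDerivWithinAt (fun θ : ℝ => 2 * Real.sin (θ / 2))
      (Real.cos (θ / 2)) (Set.Ioo 0 Real.pi) θ := by
    intro θ _
    have := (((hasDerivAt_id θ).div_const 2).sin).const_mul 2
    have hc : 2 * (Real.cos (id θ / 2) * (1 / 2)) = Real.cos (θ / 2) := by simp only [id]; ring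
    rw [hc] at this
    exact this.hasDerivWithinAt
  have hsub := lintegral_image_eq_lintegral_abs_deriv_mul measurableSet_Ioo hderiv hinj
    (fun r => ENNReal.ofReal (4 / √(4 - r ^ 2)) * H r)
  have hext : ∫⁻ r in Set.Ioi (0 : ℝ), ENNReal.ofReal (4 / √(4 - r ^ 2)) * H r =
      ∫⁻ r in Set.Ioo (0 : ℝ) 2, ENNReal.ofReal (4 / √(4 - r ^ 2)) * H r := by
    rw [← lintegral_inter_add_sdiff _ (Set.Ioi (0 : ℝ)) (measurableSet_Iio (a := (2 : ℝ))),
      Set.Ioi_inter_Iio]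
    convert add_zero _
    refine setLIntegral_eq_zero (measurableSet_Ioi.diff measurableSet_Iio) ?_
    rintro r ⟨hr, hr2⟩
    have h2 : 2 ≤ r := by
      by_contra h
      exact hr2 (not_le.1 h)
    have : √(4 - r ^ 2) = 0 := Real.sqrt_eq_zero_of_nonpos (by nlinarith)
    simp [this]
  rw [setLIntegral_congr hsplit, lintegral_union measurableSet_Ioo
    (Set.disjoint_left.2 fun x h1 h2 => lt_asymm h1.2 h2.1), hneg, hext, ← himage, hsub, ← two_mul,
    ← lintegral_const_mul' _ _ (by simp)]
  refine setLIntegral_congr_fun measurableSet_Ioo fun θ hθ => ?_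
  have hs : 0 < Real.sin (θ / 2) :=
    Real.sin_pos_of_pos_of_lt_pi (by linarith [hθ.1]) (by linarith [hθ.2])
  have hc : 0 < Real.cos (θ / 2) :=
    Real.cos_pos_of_mem_Ioo ⟨by linarith [hθ.1], by linarith [hθ.2]⟩
  have hsq : √(4 - (2 * Real.sin (θ / 2)) ^ 2) = 2 * Real.cos (θ / 2) := by
    rw [show 4 - (2 * Real.sin (θ / 2)) ^ 2 = (2 * Real.cos (θ / 2)) ^ 2 by
      have := Real.sin_sq_add_cos_sq (θ / 2); nlinarith, Real.sqrt_sq (by positivity)]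
  rw [hsq, abs_of_pos hs, abs_of_pos hc, ← mul_assoc, ← ENNReal.ofReal_mul hc.le]
  congr 1
  rw [show Real.cos (θ / 2) * (4 / (2 * Real.cos (θ / 2))) = 2 by field_simp; norm_num]
  simp

/-- The density `4 / (|x| √(4 - |x|²))` of the law of `x̂ - ζ`. It vanishes for `|x| ≥ 2`, where the
square root is zero by convention. -/
def diffDensity (x : Plane) : ℝ := 4 / (‖x‖ * √(4 - ‖x‖ ^ 2))

lemma diffDensity_nonneg (x : Plane) : 0 ≤ diffDensity x := by
  unfold diffDensity; positivity

lemma measurable_diffDensity : Measurable diffDensity := by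
  unfold diffDensity; fun_prop

/-- The law of `x̂ - ζ` under the product of the arc length measures is absolutely continuous. -/
lemma map_sub_circSq : circSq.map (fun p => (p.1 : Plane) - p.2) =
    volume.withDensity fun x => ENNReal.ofReal (diffDensity x) := by
  refine Measure.ext_of_lintegral _ fun F hF => ?_
  rw [lintegral_map hF (by fun_prop), lintegral_prod_symm _ (by fun_prop),
    lintegral_withDensity_eq_lintegral_mul _ measurable_diffDensity.ennreal_ofReal hF]
  simp only
  rw [lintegral_sub_eq_lintegral_norm hF]
  have hH : Measurable fun r : ℝ => ∫⁻ z : Circ, F (r • (z : Plane))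
      ∂(volume : Measure Plane).toSphere := by
    refine Measurable.lintegral_prod_right' (f := fun q : ℝ × Circ => F (q.1 • (q.2 : Plane))) ?_
    fun_prop
  have h1 := lintegral_toSphere_eq (g := fun w => ∫⁻ z : Circ, F (‖w - circPt 0‖ • (z : Plane))
    ∂(volume : Measure Plane).toSphere) (hH.comp (by fun_prop : Measurable fun w : Plane =>
      ‖w - circPt 0‖))
  rw [h1]
  simp only [norm_circPt_sub_circPt_zero]
  rw [lintegral_two_mul_sin (fun r => ∫⁻ z : Circ, F (r • (z : Plane))
    ∂(volume : Measure Plane).toSphere),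
    lintegral_plane_polar (measurable_diffDensity.ennreal_ofReal.mul hF)]
  rw [lintegral_lintegral_swap]
  · refine setLIntegral_congr_fun measurableSet_Ioi fun r hr => ?_
    have hr : 0 < r := hr
    simp only [Pi.mul_apply]
    rw [← lintegral_const_mul _ (by fun_prop)]
    refine lintegral_congr fun z => ?_
    rw [← mul_assoc, ← ENNReal.ofReal_mul hr.le]
    congr 2
    have : ‖r • (z : Plane)‖ = r := by rw [norm_smul]; simp [abs_of_pos hr]
    rw [diffDensity, this]
    field_simp
  · have := measurable_diffDensity
    refine Measurable.aemeasurable ?_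
    simp only [Pi.mul_apply, Function.uncurry_def]
    fun_prop

/-! ### Tempered distributions which are functions -/

lemma IsFunction.congr {T : 𝓢'(Plane, ℂ)} {a b : Plane → ℂ} (h : IsFunction T a)
    (hab : a =ᵐ[volume] b) : IsFunction T b := by
  intro φ
  have h1 : (fun x => φ x * a x) =ᵐ[volume] fun x => φ x * b x := by
    filter_upwards [hab] with x hx
    rw [hx]
  exact ⟨(h φ).1.congr h1, (h φ).2.trans (integral_congr_ae h1)⟩

lemma IsFunction.add {T U : 𝓢'(Plane, ℂ)} {a b : Plane → ℂ} (hT : IsFunction T a)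
    (hU : IsFunction U b) : IsFunction (T + U) (fun x => a x + b x) := by
  intro φ
  simp only [mul_add]
  refine ⟨(hT φ).1.add (hU φ).1, ?_⟩
  rw [integral_add (hT φ).1 (hU φ).1, ← (hT φ).2, ← (hU φ).2]
  rfl

lemma IsFunction.smul {T : 𝓢'(Plane, ℂ)} {a : Plane → ℂ} (c : ℂ) (hT : IsFunction T a) :
    IsFunction (c • T) (fun x => c * a x) := by
  intro φ
  simp only [mul_left_comm _ c]
  refine ⟨(hT φ).1.const_mul c, ?_⟩
  rw [integral_const_mul, ← (hT φ).2]
  rfl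

lemma isFunction_zero : IsFunction 0 (fun _ => 0) := by
  intro φ
  simp

lemma IsFunction.sum {ι : Type*} (s : Finset ι) {T : ι → 𝓢'(Plane, ℂ)} {a : ι → Plane → ℂ}
    (h : ∀ i, IsFunction (T i) (a i)) : IsFunction (∑ i ∈ s, T i) (fun x => ∑ i ∈ s, a i x) := by
  classical
  induction s using Finset.induction_on with
  | empty => simpa using isFunction_zero
  | insert i s hi ih =>
    simp only [Finset.sum_insert hi]
    exact (h i).add ih

lemma HasFourier.add {T U : 𝓢'(Plane, ℂ)} {a b : Plane → ℂ} (hT : HasFourier T a)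
    (hU : HasFourier U b) : HasFourier (T + U) (fun x => a x + b x) := by
  unfold HasFourier at *
  rw [FourierTransform.fourier_add]
  exact IsFunction.add hT hU

lemma HasFourier.smul {T : 𝓢'(Plane, ℂ)} {a : Plane → ℂ} (c : ℂ) (hT : HasFourier T a) :
    HasFourier (c • T) (fun x => c * a x) := by
  unfold HasFourier at *
  rw [FourierTransform.fourier_smul]
  exact IsFunction.smul c hT

lemma HasFourier.neg {T : 𝓢'(Plane, ℂ)} {a : Plane → ℂ} (hT : HasFourier T a) :
    HasFourier (-T) (fun x => -a x) := by
  have h : -T = (-1 : ℂ) • T := by ext φ; simp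
  rw [h]
  simpa using hT.smul (-1)

lemma hasFourier_zero : HasFourier 0 (fun _ => 0) := by
  unfold HasFourier
  rw [FourierTransform.fourier_zero]
  exact isFunction_zero

lemma HasFourier.sum {ι : Type*} (s : Finset ι) {T : ι → 𝓢'(Plane, ℂ)} {a : ι → Plane → ℂ}
    (h : ∀ i, HasFourier (T i) (a i)) : HasFourier (∑ i ∈ s, T i) (fun x => ∑ i ∈ s, a i x) := by
  unfold HasFourier at *
  rw [FourierTransform.fourier_sum]
  exact IsFunction.sum s h

lemma hasFourier_diracZero : HasFourier diracZero (fun _ => 1) := by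
  intro φ
  rw [TemperedDistribution.fourier_delta_zero]
  simpa using φ.integrable

lemma exists_isFunction_of_integrable {a : Plane → ℂ} (ha : Integrable a) :
    ∃ T : 𝓢'(Plane, ℂ), IsFunction T a := by
  have hm : MemLp a 1 := memLp_one_iff_integrable.2 ha
  refine ⟨Lp.toTemperedDistribution (hm.toLp a), fun φ => ⟨?_, ?_⟩⟩
  · exact ha.mul_of_top_right φ.memLp_top
  · rw [Lp.toTemperedDistribution_apply]
    refine integral_congr_ae ?_
    filter_upwards [hm.coeFn_toLp] with x hx
    rw [hx, smul_eq_mul]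

lemma isFunction_toLp_top {a : Plane → ℂ} (ha : MemLp a ∞ (volume : Measure Plane)) :
    IsFunction (Lp.toTemperedDistribution (ha.toLp a)) a := by
  refine fun φ => ⟨?_, ?_⟩
  · exact φ.integrable.mul_of_top_left ha
  · rw [Lp.toTemperedDistribution_apply]
    refine integral_congr_ae ?_
    filter_upwards [ha.coeFn_toLp] with x hx
    rw [hx, smul_eq_mul]

lemma exists_isFunction_of_bound {a : Plane → ℂ} (ha : Measurable a) {C : ℝ}
    (hC : ∀ x, ‖a x‖ ≤ C) : ∃ T : 𝓢'(Plane, ℂ), IsFunction T a :=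
  ⟨_, isFunction_toLp_top (memLp_top_of_bound ha.aestronglyMeasurable C
    (Filter.Eventually.of_forall hC))⟩

/-- Every function which is a tempered distribution is a Fourier transform. -/
lemma IsFunction.exists_hasFourier {T : 𝓢'(Plane, ℂ)} {a : Plane → ℂ} (h : IsFunction T a) :
    ∃ U, HasFourier U a :=
  ⟨𝓕⁻ T, by
    unfold HasFourier
    rw [FourierTransform.fourier_fourierInv_eq]
    exact h⟩

lemma continuous_neg_innerₗ : Continuous fun p : Plane × Plane => (-innerₗ Plane) p.1 p.2 := by
  simp only [LinearMap.neg_apply, innerₗ_apply_apply]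
  fun_prop

/-- The inverse Fourier integral of an integrable function has that function as its Fourier
transform in the sense of distributions. -/
lemma IsFunction.hasFourier_of_fourierInv {T : 𝓢'(Plane, ℂ)} {w : Plane → ℂ} (hw : Integrable w)
    (h : IsFunction T (𝓕⁻ w)) : HasFourier T w := by
  intro φ
  obtain ⟨S, hS⟩ := exists_isFunction_of_integrable hw
  refine ⟨(hS φ).1, ?_⟩
  rw [TemperedDistribution.fourier_apply, (h (𝓕 φ)).2]
  have := VectorFourier.integral_fourierIntegral_smul_eq_flip (μ := (volume : Measure Plane))
    (ν := (volume : Measure Plane)) (L := -innerₗ Plane) Real.continuous_fourierChar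
    continuous_neg_innerₗ (𝓕 φ).integrable hw
  have hflip : (-innerₗ Plane).flip = -innerₗ Plane := by
    ext x y; simp [real_inner_comm]
  rw [hflip] at this
  refine this.symm.trans (integral_congr_ae (Filter.Eventually.of_forall fun x => ?_))
  have hφ : 𝓕⁻ (𝓕 φ) = φ := FourierTransform.fourierInv_fourier_eq φ
  have h2 := congrArg (fun ψ : 𝓢(Plane, ℂ) => ψ x) hφ
  simp only [SchwartzMap.fourierInv_coe] at h2
  simp only [smul_eq_mul]
  rw [← h2]
  rfl

/-- The Fourier integral of an integrable function is its Fourier transform in the sense of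
distributions. -/
lemma IsFunction.hasFourier_fourier {T : 𝓢'(Plane, ℂ)} {f : Plane → ℂ} (hf : Integrable f)
    (h : IsFunction T f) : HasFourier T (𝓕 f) := by
  have hc : Continuous (𝓕 f) := VectorFourier.fourierIntegral_continuous
    Real.continuous_fourierChar continuous_inner hf
  have hb : ∀ x, ‖𝓕 f x‖ ≤ ∫ y, ‖f y‖ := fun x =>
    VectorFourier.norm_fourierIntegral_le_integral_norm _ _ _ _ _
  obtain ⟨S, hS⟩ := exists_isFunction_of_bound hc.measurable hb
  intro φ
  refine ⟨(hS φ).1, ?_⟩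
  rw [TemperedDistribution.fourier_apply, (h (𝓕 φ)).2]
  have := VectorFourier.integral_fourierIntegral_smul_eq_flip (μ := (volume : Measure Plane))
    (ν := (volume : Measure Plane)) (L := innerₗ Plane) Real.continuous_fourierChar
    continuous_inner φ.integrable hf
  rw [flip_innerₗ] at this
  exact this

/-- The inverse Fourier integral of an integrable function is bounded, hence a tempered
distribution. -/
lemma exists_isFunction_fourierInv {w : Plane → ℂ} (hw : Integrable w) :
    ∃ T : 𝓢'(Plane, ℂ), IsFunction T (𝓕⁻ w) ∧ HasFourier T w := by
  have hc : Continuous (𝓕⁻ w) := VectorFourier.fourierIntegral_continuous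
    Real.continuous_fourierChar continuous_neg_innerₗ hw
  have hb : ∀ x, ‖𝓕⁻ w x‖ ≤ ∫ y, ‖w y‖ := fun x =>
    VectorFourier.norm_fourierIntegral_le_integral_norm _ _ _ _ _
  obtain ⟨S, hS⟩ := exists_isFunction_of_bound hc.measurable hb
  exact ⟨S, hS, hS.hasFourier_of_fourierInv hw⟩

/-! ### Spectral densities of the filters -/

/-- The angular factor of the `j`-th unknown as a function of `x̂ - ζ`. -/
def specCoef (j : Fin 2) (x : Plane) : ℝ := ![-(1 - ‖x‖ ^ 2 / 2), 1] j

/-- The frequency `ω (x̂ - ζ) / (2π)` of the plane wave `e^{iω(x̂ - ζ)·y}`. -/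
def waveVec (ω : ℝ) (p : Circ × Circ) : Plane := (ω / (2 * Real.pi)) • ((p.1 : Plane) - p.2)

/-- The density of the law of `waveVec ω`. -/
def specDens (ω : ℝ) (ξ : Plane) : ℝ :=
  (2 * Real.pi / ω) ^ 2 * diffDensity ((2 * Real.pi / ω) • ξ)

/-- The Fourier transform of the filter `g_{jj'}^ω`. -/
def specWeight (ω : ℝ) (j j' : Fin 2) (ξ : Plane) : ℝ :=
  ‖cOmega ω‖ ^ 2 * (specCoef j ((2 * Real.pi / ω) • ξ) * specCoef j' ((2 * Real.pi / ω) • ξ)) *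
    specDens ω ξ

lemma continuous_specCoef (j : Fin 2) : Continuous (specCoef j) := by
  fin_cases j
  · show Continuous fun x : Plane => -(1 - ‖x‖ ^ 2 / 2)
    fun_prop
  · show Continuous fun _ => (1 : ℝ)
    fun_prop

lemma specCoef_sub (j : Fin 2) (p : Circ × Circ) :
    specCoef j ((p.1 : Plane) - p.2) = angular j p := by
  fin_cases j
  · have h1 : ‖(p.1 : Plane)‖ = 1 := by simp
    have h2 : ‖(p.2 : Plane)‖ = 1 := by simp
    have := norm_sub_sq_real (p.1 : Plane) (p.2 : Plane)
    rw [h1, h2] at this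
    simp only [specCoef, angular, dirDot, Fin.zero_eta, Matrix.cons_val_zero, this]
    ring
  · rfl

lemma continuous_waveVec (ω : ℝ) : Continuous (waveVec ω) := by
  unfold waveVec; fun_prop

lemma specDens_nonneg (ω : ℝ) (ξ : Plane) : 0 ≤ specDens ω ξ :=
  mul_nonneg (sq_nonneg _) (diffDensity_nonneg _)

lemma measurable_specDens (ω : ℝ) : Measurable (specDens ω) := by
  have := measurable_diffDensity
  unfold specDens; fun_prop

lemma measurable_specWeight (ω : ℝ) (j j' : Fin 2) : Measurable (specWeight ω j j') := by
  have := measurable_specDens ω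
  have := (continuous_specCoef j).measurable
  have := (continuous_specCoef j').measurable
  unfold specWeight; fun_prop

lemma specWeight_comm (ω : ℝ) (j j' : Fin 2) (ξ : Plane) :
    specWeight ω j j' ξ = specWeight ω j' j ξ := by
  unfold specWeight; ring

lemma waveVec_smul {ω : ℝ} (hω : 0 < ω) (p : Circ × Circ) :
    (2 * Real.pi / ω) • waveVec ω p = (p.1 : Plane) - p.2 := by
  have := Real.pi_pos
  rw [waveVec, smul_smul, show 2 * Real.pi / ω * (ω / (2 * Real.pi)) = 1 by field_simp, one_smul]

lemma two_pi_inner_waveVec (ω : ℝ) (p : Circ × Circ) (y : Plane) :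
    2 * Real.pi * inner ℝ (waveVec ω p) y = ω * phase p y := by
  have := Real.pi_pos
  rw [waveVec, real_inner_smul_left, phase]
  field_simp

lemma map_waveVec {ω : ℝ} (hω : 0 < ω) : circSq.map (waveVec ω) =
    volume.withDensity fun ξ => ENNReal.ofReal (specDens ω ξ) := by
  have hpi := Real.pi_pos
  refine Measure.ext_of_lintegral _ fun F hF => ?_
  have hs : ω / (2 * Real.pi) ≠ 0 := by positivity
  have hd := measurable_diffDensity
  have hd2 := measurable_specDens ω
  have hd3 : Measurable fun ξ : Plane =>
      ENNReal.ofReal (diffDensity ((2 * Real.pi / ω) • ξ)) * F ξ := by fun_prop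
  have h1 : ∫⁻ p, F (waveVec ω p) ∂circSq =
      ∫⁻ x, F ((ω / (2 * Real.pi)) • x) ∂(circSq.map fun p => (p.1 : Plane) - p.2) := by
    rw [lintegral_map (by fun_prop) (by fun_prop)]
    rfl
  have h2 : ∀ x : Plane, ENNReal.ofReal (diffDensity x) * F ((ω / (2 * Real.pi)) • x) =
      (fun ξ : Plane => ENNReal.ofReal (diffDensity ((2 * Real.pi / ω) • ξ)) * F ξ)
        ((ω / (2 * Real.pi)) • x) := by
    intro x
    simp only
    rw [smul_smul, show 2 * Real.pi / ω * (ω / (2 * Real.pi)) = 1 by field_simp, one_smul]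
  rw [lintegral_map hF (continuous_waveVec ω).measurable, h1, map_sub_circSq,
    lintegral_withDensity_eq_lintegral_mul _ hd.ennreal_ofReal (by fun_prop),
    lintegral_withDensity_eq_lintegral_mul _ hd2.ennreal_ofReal hF]
  simp only [Pi.mul_apply]
  rw [lintegral_congr h2, ← lintegral_map hd3 (by fun_prop),
    Measure.map_addHaar_smul _ hs, lintegral_smul_measure, smul_eq_mul, ← lintegral_const_mul _ hd3]
  refine lintegral_congr fun ξ => ?_
  rw [← mul_assoc, ← ENNReal.ofReal_mul (abs_nonneg _)]
  congr 3
  have : Module.finrank ℝ Plane = 2 := by simp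
  rw [this, abs_of_nonneg (by positivity), div_pow, inv_div, div_pow]

lemma integrable_circSq {g : Circ × Circ → ℂ} (hg : Continuous g) : Integrable g circSq := by
  obtain ⟨C, hC⟩ := isCompact_univ.exists_bound_of_continuousOn hg.continuousOn
  exact Integrable.of_bound hg.aestronglyMeasurable C
    (Filter.Eventually.of_forall fun p => hC p (Set.mem_univ _))

lemma integrable_specDens_mul {ω : ℝ} (hω : 0 < ω) {g : Plane → ℂ} (hg : Continuous g) :
    Integrable fun ξ => (specDens ω ξ : ℂ) * g ξ := by
  have h1 : Integrable g (circSq.map (waveVec ω)) :=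
    (integrable_map_measure hg.aestronglyMeasurable (continuous_waveVec ω).aemeasurable).2
      (integrable_circSq (hg.comp (continuous_waveVec ω)))
  rw [map_waveVec hω, integrable_withDensity_iff_integrable_smul'
    (measurable_specDens ω).ennreal_ofReal (by simp)] at h1
  refine h1.congr (Filter.Eventually.of_forall fun ξ => ?_)
  simp [ENNReal.toReal_ofReal (specDens_nonneg ω ξ)]

lemma integral_waveVec {ω : ℝ} (hω : 0 < ω) {g : Plane → ℂ} (hg : Continuous g) :
    ∫ p, g (waveVec ω p) ∂circSq = ∫ ξ, (specDens ω ξ : ℂ) * g ξ := by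
  rw [← integral_map (continuous_waveVec ω).aemeasurable hg.aestronglyMeasurable, map_waveVec hω,
    integral_withDensity_eq_integral_toReal_smul (measurable_specDens ω).ennreal_ofReal (by simp)]
  refine integral_congr_ae (Filter.Eventually.of_forall fun ξ => ?_)
  simp [ENNReal.toReal_ofReal (specDens_nonneg ω ξ)]

lemma continuous_specCoef_mul (ω : ℝ) (j j' : Fin 2) {g : Plane → ℂ} (hg : Continuous g) :
    Continuous fun ξ : Plane => ((‖cOmega ω‖ ^ 2 * (specCoef j ((2 * Real.pi / ω) • ξ) *
      specCoef j' ((2 * Real.pi / ω) • ξ)) : ℝ) : ℂ) * g ξ := by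
  have := continuous_specCoef j
  have := continuous_specCoef j'
  fun_prop

lemma integrable_specWeight_mul {ω : ℝ} (hω : 0 < ω) (j j' : Fin 2) {g : Plane → ℂ}
    (hg : Continuous g) : Integrable fun ξ => (specWeight ω j j' ξ : ℂ) * g ξ := by
  refine (integrable_specDens_mul hω (continuous_specCoef_mul ω j j' hg)).congr
    (Filter.Eventually.of_forall fun ξ => ?_)
  simp only [specWeight]
  push_cast
  ring

lemma integrable_specWeight {ω : ℝ} (hω : 0 < ω) (j j' : Fin 2) :
    Integrable fun ξ => (specWeight ω j j' ξ : ℂ) := by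
  simpa using integrable_specWeight_mul hω j j' (continuous_const (y := (1 : ℂ)))

lemma integral_specWeight_mul {ω : ℝ} (hω : 0 < ω) (j j' : Fin 2) {g : Plane → ℂ}
    (hg : Continuous g) : ∫ ξ, (specWeight ω j j' ξ : ℂ) * g ξ =
      (‖cOmega ω‖ : ℂ) ^ 2 * ∫ p, (angular j p : ℂ) * angular j' p * g (waveVec ω p) ∂circSq := by
  rw [← integral_const_mul]
  have := integral_waveVec hω (continuous_specCoef_mul ω j j' hg)
  simp only [waveVec_smul hω, specCoef_sub] at this
  refine Eq.trans (integral_congr_ae (Filter.Eventually.of_forall fun ξ => ?_))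
    (this.symm.trans (integral_congr_ae (Filter.Eventually.of_forall fun p => ?_)))
  · simp only [specWeight]
    push_cast
    ring
  · push_cast
    ring

/-- The inverse Fourier integral against `specWeight` is a superposition of plane waves over
`𝕊 × 𝕊`. -/
lemma fourierInv_specWeight_mul {ω : ℝ} (hω : 0 < ω) (j j' : Fin 2) {g : Plane → ℂ}
    (hg : Continuous g) (y : Plane) : 𝓕⁻ (fun ξ => (specWeight ω j j' ξ : ℂ) * g ξ) y =
      (‖cOmega ω‖ : ℂ) ^ 2 * ∫ p, (angular j p : ℂ) * angular j' p *
        (Complex.exp (Complex.I * ((ω * phase p y : ℝ) : ℂ)) * g (waveVec ω p)) ∂circSq := by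
  have h := integral_specWeight_mul hω j j'
    (g := fun ξ => Complex.exp (Complex.I * ((2 * Real.pi * inner ℝ ξ y : ℝ) : ℂ)) * g ξ)
    (by fun_prop)
  simp only [two_pi_inner_waveVec] at h
  rw [← h, Real.fourierInv_eq']
  refine integral_congr_ae (Filter.Eventually.of_forall fun ξ => ?_)
  simp only [smul_eq_mul]
  rw [mul_comm Complex.I]
  ring

lemma continuous_phase_left (y : Plane) : Continuous fun p : Circ × Circ => phase p y :=
  continuous_phase.comp (by fun_prop : Continuous fun p : Circ × Circ => (p, y))

lemma angular_swap (j : Fin 2) (p : Circ × Circ) : angular j p.swap = angular j p := by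
  simp [angular, dirDot, real_inner_comm]

lemma phase_swap (p : Circ × Circ) (y : Plane) : phase p.swap y = -phase p y := by
  simp [phase, ← inner_neg_left]

lemma neg_one_pow_mul_dirDot_pow (j j' : Fin 2) (p : Circ × Circ) :
    (-1) ^ ((j : ℕ) + (j' : ℕ)) * dirDot p ^ (4 - ((j : ℕ) + 1) - ((j' : ℕ) + 1)) =
      angular j p * angular j' p := by
  fin_cases j <;> fin_cases j' <;> simp [angular, sq]

lemma gFilter_eq (ω : ℝ) (j j' : Fin 2) (y : Plane) : gFilter ω j j' y =
    ‖cOmega ω‖ ^ 2 * ∫ p, angular j p * angular j' p * Real.cos (ω * phase p y) ∂circSq := by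
  rw [gFilter, mul_comm ((-1 : ℝ) ^ _), mul_assoc, ← integral_const_mul]
  simp only [← neg_one_pow_mul_dirDot_pow, mul_assoc]

/-- The imaginary part of the superposition of plane waves vanishes, since exchanging `x̂` and `ζ`
conjugates the plane wave. -/
lemma gFilter_eq_fourierInv {ω : ℝ} (hω : 0 < ω) (j j' : Fin 2) (y : Plane) :
    (gFilter ω j j' y : ℂ) = 𝓕⁻ (fun ξ => (specWeight ω j j' ξ : ℂ)) y := by
  have h := fourierInv_specWeight_mul hω j j' (continuous_const (y := (1 : ℂ))) y
  simp only [mul_one] at h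
  rw [h, gFilter_eq]
  have hp := continuous_phase_left y
  have ha := continuous_angular j
  have ha' := continuous_angular j'
  have hsin :
      ∫ p, ((angular j p * angular j' p * Real.sin (ω * phase p y) : ℝ) : ℂ) ∂circSq = 0 := by
    have hsw := integral_prod_swap (μ := (volume : Measure Plane).toSphere)
      (ν := (volume : Measure Plane).toSphere)
      (fun p : Circ × Circ => ((angular j p * angular j' p * Real.sin (ω * phase p y) : ℝ) : ℂ))
    simp only [angular_swap, phase_swap, mul_neg, Real.sin_neg, Complex.ofReal_neg] at hsw
    rw [integral_neg] at hsw
    exact CharZero.neg_eq_self_iff.1 hsw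
  rw [Complex.ofReal_mul, Complex.ofReal_pow, ← integral_complex_ofReal]
  congr 1
  have hsplit : ∀ p : Circ × Circ, (angular j p : ℂ) * angular j' p *
      Complex.exp (Complex.I * ((ω * phase p y : ℝ) : ℂ)) =
      ((angular j p * angular j' p * Real.cos (ω * phase p y) : ℝ) : ℂ) +
        Complex.I * ((angular j p * angular j' p * Real.sin (ω * phase p y) : ℝ) : ℂ) := by
    intro p
    rw [mul_comm Complex.I, Complex.exp_mul_I]
    push_cast
    ring
  simp only [hsplit]
  rw [integral_add (integrable_circSq (by fun_prop)) (integrable_circSq (by fun_prop)),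
    integral_const_mul, hsin, mul_zero, add_zero]

lemma isFunction_gDist (ω : ℝ) (j j' : Fin 2) :
    IsFunction (gDist ω j j') (fun y => (gFilter ω j j' y : ℂ)) :=
  isFunction_toLp_top _

lemma hasFourier_gDist {ω : ℝ} (hω : 0 < ω) (j j' : Fin 2) :
    HasFourier (gDist ω j j') (fun ξ => (specWeight ω j j' ξ : ℂ)) := by
  refine IsFunction.hasFourier_of_fourierInv (integrable_specWeight hω j j') ?_
  have : 𝓕⁻ (fun ξ => (specWeight ω j j' ξ : ℂ)) = fun y => (gFilter ω j j' y : ℂ) :=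
    funext fun y => (gFilter_eq_fourierInv hω j j' y).symm
  rw [this]
  exact isFunction_gDist ω j j'

/-- The filters are radially symmetric because the arc length measure is invariant under the
reflection which exchanges two given points on a circle about the origin. -/
lemma gFilter_radial (ω : ℝ) (j j' : Fin 2) {y y' : Plane} (h : ‖y‖ = ‖y'‖) :
    gFilter ω j j' y = gFilter ω j j' y' := by
  set A : Plane ≃ₗᵢ[ℝ] Plane := (ℝ ∙ (y - y'))ᗮ.reflection with hA
  have hAy : A y = y' := Submodule.reflection_sub h
  have hmp := (measurePreserving_sphereMap A).prod (measurePreserving_sphereMap A)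
  have hphase : ∀ p : Circ × Circ,
      phase (Prod.map (sphereMap A) (sphereMap A) p) y' = phase p y := by
    intro p
    simp only [phase, Prod.map, sphereMap]
    rw [← hAy, ← map_sub, LinearIsometryEquiv.inner_map_map]
  have hdot : ∀ p : Circ × Circ, ∀ j, angular j (Prod.map (sphereMap A) (sphereMap A) p) =
      angular j p := by
    intro p j
    have : dirDot (Prod.map (sphereMap A) (sphereMap A) p) = dirDot p :=
      A.inner_map_map _ _
    simp only [angular, this]
  have hc := continuous_phase_left y'
  have ha := continuous_angular j
  have ha' := continuous_angular j'
  have hm : Continuous fun p : Circ × Circ => angular j p * angular j' p *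
    Real.cos (ω * phase p y') := by fun_prop
  have := integral_map (μ := circSq) hmp.measurable.aemeasurable hm.aestronglyMeasurable
  rw [hmp.map_eq] at this
  rw [gFilter_eq, gFilter_eq, this]
  simp only [hphase, hdot]

/-! ### The forward operator and its adjoint -/

lemma integrable_zeroExt {R : ℝ} (f : L2BallPair R) (j : Fin 2) : Integrable (zeroExt f j) :=
  (integrable_indicator_iff measurableSet_ball).2 (integrable_L2Ball (f j))

lemma continuous_fourier_zeroExt {R : ℝ} (f : L2BallPair R) (j : Fin 2) :
    Continuous (𝓕 (zeroExt f j)) :=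
  VectorFourier.fourierIntegral_continuous Real.continuous_fourierChar continuous_inner
    (integrable_zeroExt f j)

/-- The data are samples of the Fourier transform of the unknowns at the wave vectors. -/
lemma fwdFun_eq_fourier (ω : ℝ) (j : Fin 2) {R : ℝ} (f : L2BallPair R) (p : Circ × Circ) :
    fwdFun ω j (f j) p = cOmega ω * angular j p * 𝓕 (zeroExt f j) (waveVec ω p) := by
  show ∫ y in Metric.ball (0 : Plane) R, fwdKernel ω j p y * f j y = _
  rw [← integral_indicator measurableSet_ball, Real.fourier_eq', ← integral_const_mul]
  refine integral_congr_ae (Filter.Eventually.of_forall fun y => ?_)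
  by_cases hy : y ∈ Metric.ball (0 : Plane) R
  · simp only [zeroExt, Set.indicator_of_mem hy, smul_eq_mul, fwdKernel]
    rw [real_inner_comm, neg_mul, neg_mul, two_pi_inner_waveVec, Complex.ofReal_neg, neg_mul,
      mul_comm Complex.I]
    ring
  · simp [zeroExt, Set.indicator_of_notMem hy]

lemma forwardOp_apply (ω : Fin 2 → ℝ) (R : ℝ) (f : L2BallPair R) (i : Fin 2) :
    forwardOp ω R f i = ∑ j, fwdOp (ω i) j R (f j) := by
  simp [forwardOp]

lemma fwdOp_coeFn (ω : ℝ) (j : Fin 2) {R : ℝ} (f : L2Ball R) :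
    fwdOp ω j R f =ᵐ[circSq] fwdFun ω j f :=
  ContinuousMap.coeFn_toLp circSq (𝕜 := ℂ) (fwdFun ω j f)

lemma forwardOp_coeFn (ω : Fin 2 → ℝ) (R : ℝ) (f : L2BallPair R) (i : Fin 2) :
    forwardOp ω R f i =ᵐ[circSq] fun p => ∑ j, fwdFun (ω i) j (f j) p := by
  rw [forwardOp_apply, Fin.sum_univ_two]
  filter_upwards [Lp.coeFn_add (fwdOp (ω i) 0 R (f 0)) (fwdOp (ω i) 1 R (f 1)),
    fwdOp_coeFn (ω i) 0 (f 0), fwdOp_coeFn (ω i) 1 (f 1)] with p h h0 h1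
  rw [h, Pi.add_apply, h0, h1, Fin.sum_univ_two]

lemma adjointFormula_forwardOp {ω : Fin 2 → ℝ} (hω : ∀ i, 0 < ω i) {R : ℝ} (f : L2BallPair R)
    (j : Fin 2) (y : Plane) : adjointFormula ω (forwardOp ω R f) j y =
      ∑ i, ∑ j', 𝓕⁻ (fun ξ => (specWeight (ω i) j j' ξ : ℂ) * 𝓕 (zeroExt f j') ξ) y := by
  unfold adjointFormula
  refine Finset.sum_congr rfl fun i _ => ?_
  have hp := continuous_phase_left y
  have ha := continuous_angular j
  have hw := continuous_waveVec (ω i)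
  have hint : ∀ j', Integrable (fun p => (angular j p : ℂ) * angular j' p *
      (Complex.exp (Complex.I * ((ω i * phase p y : ℝ) : ℂ)) *
        𝓕 (zeroExt f j') (waveVec (ω i) p))) circSq := by
    intro j'
    have ha' := continuous_angular j'
    have hf := (continuous_fourier_zeroExt f j').comp hw
    refine integrable_circSq ?_
    fun_prop
  simp only [fun j' => fourierInv_specWeight_mul (hω i) j j' (continuous_fourier_zeroExt f j') y]
  rw [← Finset.mul_sum, ← integral_finsetSum _ fun j' _ => hint j', ← Complex.conj_mul', mul_assoc]
  congr 1
  rw [← integral_const_mul]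
  refine integral_congr_ae ?_
  filter_upwards [forwardOp_coeFn ω R f i] with p hp
  rw [hp]
  simp only [fwdFun_eq_fourier, Finset.mul_sum]
  exact Finset.sum_congr rfl fun j' _ => by ring

/-- One summand of the explicit formula for the adjoint. -/
def backFun (ω : ℝ) (j : Fin 2) (Λ : L2Data) (y : Plane) : ℂ :=
  starRingEnd ℂ (cOmega ω) *
    ∫ p, (angular j p : ℂ) * Complex.exp (Complex.I * ((ω * phase p y : ℝ) : ℂ)) * Λ p ∂circSq

lemma integrable_L2Data (Λ : L2Data) : Integrable Λ circSq :=
  (Lp.memLp Λ).integrable (by norm_num)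

lemma norm_angular_mul_exp_le (ω : ℝ) (j : Fin 2) (p : Circ × Circ) (y : Plane) :
    ‖(angular j p : ℂ) * Complex.exp (Complex.I * ((ω * phase p y : ℝ) : ℂ))‖ ≤ 1 := by
  rw [norm_mul, mul_comm Complex.I, Complex.norm_exp_ofReal_mul_I, mul_one, Complex.norm_real]
  exact abs_angular_le j p

lemma continuous_backFun (ω : ℝ) (j : Fin 2) (Λ : L2Data) : Continuous (backFun ω j Λ) := by
  have h1 := continuous_phase
  have h2 := continuous_angular j
  refine continuous_const.mul (continuous_of_dominated (bound := fun p => ‖Λ p‖) ?_ ?_ ?_ ?_)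
  · intro y
    have := continuous_phase_left y
    exact Continuous.aestronglyMeasurable (by fun_prop) |>.mul
      (integrable_L2Data Λ).aestronglyMeasurable
  · refine fun y => Filter.Eventually.of_forall fun p => ?_
    rw [norm_mul]
    exact mul_le_of_le_one_left (norm_nonneg _) (norm_angular_mul_exp_le ω j p y)
  · exact (integrable_L2Data Λ).norm
  · refine Filter.Eventually.of_forall fun p => ?_
    have : Continuous fun y : Plane => phase p y :=
      h1.comp (by fun_prop : Continuous fun y : Plane => (p, y))
    fun_prop

lemma norm_backFun_le (ω : ℝ) (j : Fin 2) (Λ : L2Data) (y : Plane) :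
    ‖backFun ω j Λ y‖ ≤ ‖cOmega ω‖ * ∫ p, ‖Λ p‖ ∂circSq := by
  rw [backFun, norm_mul, RCLike.norm_conj]
  refine mul_le_mul_of_nonneg_left ?_ (norm_nonneg _)
  refine norm_integral_le_of_norm_le (integrable_L2Data Λ).norm
    (Filter.Eventually.of_forall fun p => ?_)
  rw [norm_mul]
  exact mul_le_of_le_one_left (norm_nonneg _) (norm_angular_mul_exp_le ω j p y)

lemma memLp_backFun (ω : ℝ) (j : Fin 2) (Λ : L2Data) (R : ℝ) :
    MemLp (backFun ω j Λ) 2 (ballMeasure R) :=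
  MemLp.of_bound (continuous_backFun ω j Λ).aestronglyMeasurable _
    (Filter.Eventually.of_forall (norm_backFun_le ω j Λ))

/-- The summands of the forward operator and of the explicit formula are adjoint, by Fubini's
theorem. -/
lemma inner_fwdOp (ω : ℝ) (j : Fin 2) {R : ℝ} (f : L2Ball R) (Λ : L2Data) :
    inner ℂ (fwdOp ω j R f) Λ = inner ℂ f ((memLp_backFun ω j Λ R).toLp _) := by
  rw [L2.inner_def, L2.inner_def]
  simp only [RCLike.inner_apply]
  have hL : ∫ p, Λ p * starRingEnd ℂ (fwdOp ω j R f p) ∂circSq =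
      ∫ p, ∫ y, Λ p * starRingEnd ℂ (fwdKernel ω j p y * f y) ∂(ballMeasure R) ∂circSq := by
    refine integral_congr_ae ?_
    filter_upwards [fwdOp_coeFn ω j f] with p hp
    rw [hp, integral_const_mul, integral_conj]
    rfl
  have hR : ∫ y, (memLp_backFun ω j Λ R).toLp _ y * starRingEnd ℂ (f y) ∂(ballMeasure R) =
      ∫ y, ∫ p, Λ p * starRingEnd ℂ (fwdKernel ω j p y * f y) ∂circSq ∂(ballMeasure R) := by
    refine integral_congr_ae ?_
    filter_upwards [(memLp_backFun ω j Λ R).coeFn_toLp] with y hy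
    rw [hy, backFun, ← integral_const_mul, ← integral_mul_const]
    refine integral_congr_ae (Filter.Eventually.of_forall fun p => ?_)
    simp only [fwdKernel, map_mul, ← Complex.exp_conj, map_neg, Complex.conj_I, Complex.conj_ofReal]
    simp only [neg_mul, neg_neg]
    ring
  rw [hL, hR, integral_integral_swap]
  have h1 : Integrable (fun q : (Circ × Circ) × Plane => Λ q.1 * starRingEnd ℂ (f q.2))
      (circSq.prod (ballMeasure R)) := by
    refine (integrable_L2Data Λ).mul_prod (g := fun y => starRingEnd ℂ (f y)) ?_
    exact (RCLike.conjLIE (K := ℂ)).integrable_comp_iff.2 (integrable_L2Ball f)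
  have h2 := h1.bdd_mul (f := fun q : (Circ × Circ) × Plane =>
    starRingEnd ℂ (fwdKernel ω j q.1 q.2)) (c := ‖cOmega ω‖)
    (RCLike.continuous_conj.comp (continuous_fwdKernel ω j)).aestronglyMeasurable
    (Filter.Eventually.of_forall fun q => by
      rw [RCLike.norm_conj]; exact norm_fwdKernel_le ω j q.1 q.2)
  refine h2.congr (Filter.Eventually.of_forall fun q => ?_)
  simp only [Function.uncurry_def, map_mul]
  ring

/-- The pair of functions in `L²` given by the explicit formula for the adjoint. -/
def backPair (ω : Fin 2 → ℝ) (R : ℝ) (Λ : L2DataPair) : L2BallPair R :=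
  WithLp.toLp 2 fun j => ∑ i, (memLp_backFun (ω i) j (Λ i) R).toLp _

lemma adjoint_forwardOp (ω : Fin 2 → ℝ) (R : ℝ) (Λ : L2DataPair) :
    ContinuousLinearMap.adjoint (forwardOp ω R) Λ = backPair ω R Λ := by
  refine ext_inner_left ℂ fun f => ?_
  rw [ContinuousLinearMap.adjoint_inner_right, PiLp.inner_apply, PiLp.inner_apply]
  simp only [forwardOp_apply, sum_inner, backPair, inner_sum, inner_fwdOp]
  exact Finset.sum_comm

lemma adjoint_forwardOp_coeFn (ω : Fin 2 → ℝ) (R : ℝ) (Λ : L2DataPair) (j : Fin 2) :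
    ∀ᵐ y ∂(ballMeasure R),
      ContinuousLinearMap.adjoint (forwardOp ω R) Λ j y = adjointFormula ω Λ j y := by
  rw [adjoint_forwardOp]
  have h : backPair ω R Λ j = (memLp_backFun (ω 0) j (Λ 0) R).toLp _ +
      (memLp_backFun (ω 1) j (Λ 1) R).toLp _ := by
    simp [backPair, Fin.sum_univ_two]
  rw [h]
  filter_upwards [Lp.coeFn_add ((memLp_backFun (ω 0) j (Λ 0) R).toLp _)
    ((memLp_backFun (ω 1) j (Λ 1) R).toLp _), (memLp_backFun (ω 0) j (Λ 0) R).coeFn_toLp,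
    (memLp_backFun (ω 1) j (Λ 1) R).coeFn_toLp] with y h h0 h1
  rw [h, Pi.add_apply, h0, h1, adjointFormula, Fin.sum_univ_two]
  rfl

lemma isUnit_normalOp (ω : Fin 2 → ℝ) {α : ℝ} (hα : 0 < α) (R : ℝ) :
    IsUnit (normalOp ω α R) := by
  refine ContinuousLinearMap.isUnit_of_forall_le_norm_inner_map _ (c := ⟨α, hα.le⟩) hα fun f => ?_
  have h : inner ℂ (normalOp ω α R f) f =
      ((‖forwardOp ω R f‖ ^ 2 + α * ‖f‖ ^ 2 : ℝ) : ℂ) := by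
    simp only [normalOp, add_apply, ContinuousLinearMap.comp_apply,
      smul_apply, ContinuousLinearMap.id_apply, inner_add_left,
      inner_smul_left, ContinuousLinearMap.adjoint_inner_left, inner_self_eq_norm_sq_to_K]
    simp
  rw [h, Complex.norm_real, Real.norm_of_nonneg (by positivity)]
  show ‖f‖ ^ 2 * α ≤ _
  nlinarith [sq_nonneg ‖forwardOp ω R f‖]

lemma normalOp_coeFn (ω : Fin 2 → ℝ) (α R : ℝ) (f : L2BallPair R) (j : Fin 2) :
    ∀ᵐ y ∂(ballMeasure R), normalOp ω α R f j y = normalPlane ω α f j y := by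
  have h : normalOp ω α R f j =
      ContinuousLinearMap.adjoint (forwardOp ω R) (forwardOp ω R f) j + (α : ℂ) • f j := rfl
  rw [h]
  filter_upwards [Lp.coeFn_add (ContinuousLinearMap.adjoint (forwardOp ω R) (forwardOp ω R f) j)
    ((α : ℂ) • f j), Lp.coeFn_smul (α : ℂ) (f j), adjoint_forwardOp_coeFn ω R (forwardOp ω R f) j,
    ae_restrict_mem measurableSet_ball] with y h1 h2 h3 hy
  rw [h1, Pi.add_apply, h2, h3, normalPlane, zeroExt, Set.indicator_of_mem hy]
  rfl

/-! ### The convolution formula -/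

/-- The convolution theorem for one filter. -/
lemma fourierInv_specWeight_mul_fourier {ω : ℝ} (hω : 0 < ω) (j j' : Fin 2) {f : Plane → ℂ}
    (hf : Integrable f) (y : Plane) :
    𝓕⁻ (fun ξ => (specWeight ω j j' ξ : ℂ) * 𝓕 f ξ) y =
      ∫ z, (gFilter ω j j' (y - z) : ℂ) * f z := by
  have hw : Integrable fun ξ : Plane =>
      (specWeight ω j j' ξ : ℂ) * Complex.exp ((2 * Real.pi * inner ℝ ξ y : ℝ) * Complex.I) :=
    integrable_specWeight_mul hω j j' (by fun_prop)
  have h := VectorFourier.integral_fourierIntegral_smul_eq_flip (μ := (volume : Measure Plane))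
    (ν := (volume : Measure Plane)) (L := innerₗ Plane) Real.continuous_fourierChar
    continuous_inner hw hf
  rw [flip_innerₗ] at h
  rw [Real.fourierInv_eq']
  refine Eq.trans (integral_congr_ae (Filter.Eventually.of_forall fun ξ => ?_))
    (h.symm.trans (integral_congr_ae (Filter.Eventually.of_forall fun z => ?_)))
  · simp only [smul_eq_mul]
    rw [← mul_assoc, mul_comm (Complex.exp _)]
    rfl
  -- The Fourier integral of `specWeight` times the plane wave `e^{2πi ξ·y}` at `z` is the filter at
  -- `y - z`.
  · simp only [smul_eq_mul]
    rw [gFilter_eq_fourierInv hω, Real.fourierInv_eq']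
    congr 1
    refine (Real.fourier_eq' _ z).trans
      (integral_congr_ae (Filter.Eventually.of_forall fun ξ => ?_))
    simp only [smul_eq_mul]
    rw [mul_left_comm, ← Complex.exp_add, mul_comm (Complex.exp _), ← add_mul,
      ← Complex.ofReal_add, inner_sub_right]
    congr 5
    ring

lemma normalPlane_eq_conv {ω : Fin 2 → ℝ} (hω : ∀ i, 0 < ω i) (α : ℝ) {R : ℝ} (f : L2BallPair R)
    (j : Fin 2) (y : Plane) : normalPlane ω α f j y =
      ∑ i, ∑ j', ((∫ z, (gFilter (ω i) j j' (y - z) : ℂ) * zeroExt f j' z) +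
        if j = j' then ((α / 2 : ℝ) : ℂ) * zeroExt f j' y else 0) := by
  rw [normalPlane, adjointFormula_forwardOp hω]
  simp only [Finset.sum_add_distrib, fun i j' => fourierInv_specWeight_mul_fourier (hω i) j j'
    (integrable_zeroExt f j') y, Finset.sum_ite_eq, Finset.mem_univ, if_true, Finset.sum_const]
  congr 1
  simp only [Finset.card_univ, Fintype.card_fin]
  push_cast
  ring

/-! ### The matrix symbol -/

/-- The Fourier transform of `gEntry ω α j j'`. -/
def entrySymbol (ω α : ℝ) (j j' : Fin 2) (ξ : Plane) : ℝ :=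
  specWeight ω j j' ξ + if j = j' then α / 2 else 0

/-- The Fourier transform of the matrix kernel `𝐠`. -/
def matrixSymbol (ω : Fin 2 → ℝ) (α : ℝ) (ξ : Plane) : Matrix (Fin 2) (Fin 2) ℝ :=
  Matrix.of fun j j' => ∑ i, entrySymbol (ω i) α j j' ξ

lemma measurable_entrySymbol (ω α : ℝ) (j j' : Fin 2) : Measurable (entrySymbol ω α j j') :=
  (measurable_specWeight ω j j').add_const _

lemma measurable_matrixSymbol (ω : Fin 2 → ℝ) (α : ℝ) (j j' : Fin 2) :
    Measurable fun ξ => matrixSymbol ω α ξ j j' :=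
  Finset.measurable_sum Finset.univ fun i _ => measurable_entrySymbol (ω i) α j j'

lemma hasFourier_gEntry {ω : ℝ} (hω : 0 < ω) (α : ℝ) (j j' : Fin 2) :
    HasFourier (gEntry ω α j j') (fun ξ => (entrySymbol ω α j j' ξ : ℂ)) := by
  unfold gEntry entrySymbol
  split_ifs with h
  · simpa using (hasFourier_gDist hω j j').add (hasFourier_diracZero.smul ((α / 2 : ℝ) : ℂ))
  · simpa using hasFourier_gDist hω j j'

lemma hasFourier_gKernel {ω : Fin 2 → ℝ} (hω : ∀ i, 0 < ω i) (α : ℝ) (j j' : Fin 2) :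
    HasFourier (gKernel ω α j j') (fun ξ => (matrixSymbol ω α ξ j j' : ℂ)) := by
  simpa [gKernel, matrixSymbol] using
    HasFourier.sum Finset.univ fun i => hasFourier_gEntry (hω i) α j j'

lemma entrySymbol_comm (ω α : ℝ) (j j' : Fin 2) (ξ : Plane) :
    entrySymbol ω α j j' ξ = entrySymbol ω α j' j ξ := by
  simp only [entrySymbol, specWeight_comm ω j j', eq_comm (a := j)]

lemma matrixSymbol_isSymm (ω : Fin 2 → ℝ) (α : ℝ) (ξ : Plane) : (matrixSymbol ω α ξ).IsSymm := by
  ext j j'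
  simp only [Matrix.transpose_apply, matrixSymbol, Matrix.of_apply, entrySymbol_comm _ _ j j']

lemma hasFourier_gAdj {ω : Fin 2 → ℝ} (hω : ∀ i, 0 < ω i) (α : ℝ) (j j' : Fin 2) :
    HasFourier (gAdj ω α j j') (fun ξ => ((matrixSymbol ω α ξ).adjugate j j' : ℂ)) := by
  have h : (fun ξ => ((matrixSymbol ω α ξ).adjugate j j' : ℂ)) = fun ξ => ∑ i,
      ((!![entrySymbol (ω i) α 1 1 ξ, -entrySymbol (ω i) α 0 1 ξ;
        -entrySymbol (ω i) α 1 0 ξ, entrySymbol (ω i) α 0 0 ξ] j j' : ℝ) : ℂ) := by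
    funext ξ
    rw [Matrix.adjugate_fin_two]
    fin_cases j <;> fin_cases j' <;> simp [matrixSymbol, Fin.sum_univ_two, add_comm]
  rw [h]
  refine HasFourier.sum Finset.univ fun i => ?_
  fin_cases j <;> fin_cases j' <;> simp
  · exact hasFourier_gEntry (hω i) α 1 1
  · exact (hasFourier_gEntry (hω i) α 0 1).neg
  · exact (hasFourier_gEntry (hω i) α 1 0).neg
  · exact hasFourier_gEntry (hω i) α 0 0

/-- The common density of the spectral weights: `specWeight ω j j'` is this density times the
angular factors. -/
def scaledDens (ω : ℝ) (ξ : Plane) : ℝ := ‖cOmega ω‖ ^ 2 * specDens ω ξ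

lemma scaledDens_nonneg (ω : ℝ) (ξ : Plane) : 0 ≤ scaledDens ω ξ :=
  mul_nonneg (sq_nonneg _) (specDens_nonneg ω ξ)

lemma specWeight_eq (ω : ℝ) (j j' : Fin 2) (ξ : Plane) : specWeight ω j j' ξ =
    scaledDens ω ξ * (specCoef j ((2 * Real.pi / ω) • ξ) * specCoef j' ((2 * Real.pi / ω) • ξ)) := by
  unfold specWeight scaledDens; ring

lemma specCoef_one (x : Plane) : specCoef 1 x = 1 := rfl

/-- The part of the determinant that is quadratic in the densities. The two rank one matrices
contribute only through their interaction. -/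
def detExcess (ω : Fin 2 → ℝ) (ξ : Plane) : ℝ :=
  scaledDens (ω 0) ξ * (scaledDens (ω 1) ξ * (specCoef 0 ((2 * Real.pi / ω 0) • ξ) -
    specCoef 0 ((2 * Real.pi / ω 1) • ξ)) ^ 2)

lemma detExcess_nonneg (ω : Fin 2 → ℝ) (ξ : Plane) : 0 ≤ detExcess ω ξ :=
  mul_nonneg (scaledDens_nonneg _ _) (mul_nonneg (scaledDens_nonneg _ _) (sq_nonneg _))

lemma det_matrixSymbol (ω : Fin 2 → ℝ) (α : ℝ) (ξ : Plane) : (matrixSymbol ω α ξ).det =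
    α ^ 2 + (α * ∑ i, (specWeight (ω i) 0 0 ξ + specWeight (ω i) 1 1 ξ) + detExcess ω ξ) := by
  rw [Matrix.det_fin_two]
  simp only [matrixSymbol, Matrix.of_apply, entrySymbol, Fin.sum_univ_two, specWeight_eq,
    specCoef_one, detExcess]
  simp
  ring

lemma specWeight_self_nonneg (ω : ℝ) (j : Fin 2) (ξ : Plane) : 0 ≤ specWeight ω j j ξ := by
  rw [specWeight_eq]
  exact mul_nonneg (scaledDens_nonneg _ _) (mul_self_nonneg _)

lemma sq_le_det_matrixSymbol (ω : Fin 2 → ℝ) {α : ℝ} (hα : 0 < α) (ξ : Plane) :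
    α ^ 2 ≤ (matrixSymbol ω α ξ).det := by
  rw [det_matrixSymbol]
  have h1 : 0 ≤ ∑ i, (specWeight (ω i) 0 0 ξ + specWeight (ω i) 1 1 ξ) :=
    Finset.sum_nonneg fun i _ =>
      add_nonneg (specWeight_self_nonneg _ _ _) (specWeight_self_nonneg _ _ _)
  have := detExcess_nonneg ω ξ
  have := mul_nonneg hα.le h1
  linarith

/-- On the support of the density at the smaller frequency, the singularity of the other density at
the origin is compensated by the difference of the angular factors, and its singularity at the
boundary of its support is not attained. -/
lemma exists_bound_scaledDens_mul {ω : Fin 2 → ℝ} (hω₀ : 0 < ω 0) (hω₁ : ω 0 < ω 1) :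
    ∃ C, ∀ ξ, scaledDens (ω 0) ξ ≠ 0 → scaledDens (ω 1) ξ *
      (specCoef 0 ((2 * Real.pi / ω 0) • ξ) - specCoef 0 ((2 * Real.pi / ω 1) • ξ)) ^ 2 ≤ C := by
  have hpi := Real.pi_pos
  have hω₁' : 0 < ω 1 := hω₀.trans hω₁
  set κ : ℝ := (ω 1 / ω 0) ^ 2 - 1 with hκ
  set ρ : ℝ := ω 0 / ω 1 with hρ
  have hρ0 : 0 < ρ := div_pos hω₀ hω₁'
  have hρ1 : ρ < 1 := (div_lt_one hω₁').2 hω₁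
  refine ⟨‖cOmega (ω 1)‖ ^ 2 * (2 * Real.pi / ω 1) ^ 2 * (8 * κ ^ 2 / √(4 - (2 * ρ) ^ 2)),
    fun ξ hξ => ?_⟩
  set t : ℝ := ‖(2 * Real.pi / ω 1) • ξ‖ with ht
  have ht0 : 0 ≤ t := norm_nonneg _
  have hx0 : ‖(2 * Real.pi / ω 0) • ξ‖ = ω 1 / ω 0 * t := by
    rw [ht, norm_smul, norm_smul, Real.norm_of_nonneg (by positivity),
      Real.norm_of_nonneg (by positivity)]
    field_simp
  -- The support of the first density is `|ξ| ≤ ω 0 / π`, that is, `t ≤ 2 ρ`.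
  have hlt : t < 2 * ρ := by
    by_contra hge
    push Not at hge
    apply hξ
    have h2 : 2 ≤ ω 1 / ω 0 * t := by
      calc (2 : ℝ) = ω 1 / ω 0 * (2 * ρ) := by rw [hρ]; field_simp
        _ ≤ _ := by gcongr
    have : √(4 - (ω 1 / ω 0 * t) ^ 2) = 0 := Real.sqrt_eq_zero_of_nonpos (by nlinarith)
    simp [scaledDens, specDens, diffDensity, hx0, this]
  have hdiff : specCoef 0 ((2 * Real.pi / ω 0) • ξ) - specCoef 0 ((2 * Real.pi / ω 1) • ξ) =
      κ * t ^ 2 / 2 := by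
    show -(1 - ‖(2 * Real.pi / ω 0) • ξ‖ ^ 2 / 2) - -(1 - ‖(2 * Real.pi / ω 1) • ξ‖ ^ 2 / 2) = _
    rw [hx0, ← ht, hκ]
    ring
  have hsq : √(4 - (2 * ρ) ^ 2) ≤ √(4 - t ^ 2) := Real.sqrt_le_sqrt (by nlinarith)
  have hpos : 0 < √(4 - (2 * ρ) ^ 2) := Real.sqrt_pos.2 (by nlinarith)
  have hmain : 4 / (t * √(4 - t ^ 2)) * (κ * t ^ 2 / 2) ^ 2 ≤
      8 * κ ^ 2 / √(4 - (2 * ρ) ^ 2) := by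
    have h1 : 4 / (t * √(4 - t ^ 2)) * (κ * t ^ 2 / 2) ^ 2 = t ^ 3 * κ ^ 2 / √(4 - t ^ 2) := by
      rcases ht0.eq_or_lt with h0 | h0
      · simp [← h0]
      · have := hpos.trans_le hsq
        field_simp
        ring
    have ht3 : t ^ 3 ≤ 8 := by
      calc t ^ 3 ≤ 2 ^ 3 := by gcongr; linarith
        _ = 8 := by norm_num
    rw [h1]
    gcongr
  rw [hdiff]
  calc scaledDens (ω 1) ξ * (κ * t ^ 2 / 2) ^ 2
      = ‖cOmega (ω 1)‖ ^ 2 * (2 * Real.pi / ω 1) ^ 2 *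
        (4 / (t * √(4 - t ^ 2)) * (κ * t ^ 2 / 2) ^ 2) := by
        simp only [scaledDens, specDens, diffDensity, ← ht]; ring
    _ ≤ _ := by gcongr

lemma measurable_scaledDens (ω : ℝ) : Measurable (scaledDens ω) :=
  (measurable_specDens ω).const_mul _

lemma integrable_scaledDens {ω : ℝ} (hω : 0 < ω) : Integrable (scaledDens ω) := by
  refine (integrable_specWeight hω 1 1).re.congr (Filter.Eventually.of_forall fun ξ => ?_)
  simp [specWeight_eq, specCoef_one]

lemma integrable_detExcess {ω : Fin 2 → ℝ} (hω₀ : 0 < ω 0) (hω₁ : ω 0 < ω 1) :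
    Integrable (detExcess ω) := by
  obtain ⟨C, hC⟩ := exists_bound_scaledDens_mul hω₀ hω₁
  have h0 := measurable_scaledDens (ω 0)
  have h1 := measurable_scaledDens (ω 1)
  have h2 := (continuous_specCoef 0).measurable
  refine Integrable.mono' ((integrable_scaledDens hω₀).const_mul C) ?_
    (Filter.Eventually.of_forall fun ξ => ?_)
  · unfold detExcess
    exact Measurable.aestronglyMeasurable (by fun_prop)
  · rw [Real.norm_of_nonneg (detExcess_nonneg ω ξ), detExcess]
    by_cases h : scaledDens (ω 0) ξ = 0
    · simp [h]
    · rw [mul_comm C]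
      exact mul_le_mul_of_nonneg_left (hC ξ h) (scaledDens_nonneg _ _)

/-- The determinant is the sum of a constant and an integrable function, hence a Fourier transform
of a tempered distribution. -/
lemma exists_hasFourier_det {ω : Fin 2 → ℝ} (hω₀ : 0 < ω 0) (hω₁ : ω 0 < ω 1) (α : ℝ) :
    ∃ T, HasFourier T (fun ξ => ((matrixSymbol ω α ξ).det : ℂ)) := by
  have hω : ∀ i, 0 < ω i := Fin.forall_fin_two.2 ⟨hω₀, hω₀.trans hω₁⟩
  have hint : Integrable fun ξ => (α : ℂ) * ∑ i, ((specWeight (ω i) 0 0 ξ : ℂ) +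
      (specWeight (ω i) 1 1 ξ : ℂ)) + (detExcess ω ξ : ℂ) :=
    ((integrable_finsetSum _ fun i _ => (integrable_specWeight (hω i) 0 0).add
      (integrable_specWeight (hω i) 1 1)).const_mul _).add (integrable_detExcess hω₀ hω₁).ofReal
  obtain ⟨S, hS⟩ := exists_isFunction_of_integrable hint
  obtain ⟨S', hS'⟩ := exists_isFunction_of_bound (a := fun _ => (α : ℂ) ^ 2) measurable_const
    (fun _ => le_rfl)
  obtain ⟨T, hT⟩ := (hS'.add hS).exists_hasFourier
  refine ⟨T, ?_⟩
  simpa [det_matrixSymbol] using hT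

/-- The entries of the inverse of the matrix symbol are bounded by `1 / α`, stated without
division. -/
lemma abs_adjugate_matrixSymbol_le (ω : Fin 2 → ℝ) {α : ℝ} (hα : 0 < α) (j j' : Fin 2)
    (ξ : Plane) : α * |(matrixSymbol ω α ξ).adjugate j j'| ≤ (matrixSymbol ω α ξ).det := by
  have m0 := scaledDens_nonneg (ω 0) ξ
  have m1 := scaledDens_nonneg (ω 1) ξ
  have hE := detExcess_nonneg ω ξ
  rw [det_matrixSymbol, Matrix.adjugate_fin_two]
  simp only [matrixSymbol, Matrix.of_apply, entrySymbol, Fin.sum_univ_two, specWeight_eq,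
    specCoef_one]
  generalize scaledDens (ω 0) ξ = p at *
  generalize scaledDens (ω 1) ξ = q at *
  generalize specCoef 0 ((2 * Real.pi / ω 0) • ξ) = a at *
  generalize specCoef 0 ((2 * Real.pi / ω 1) • ξ) = b at *
  generalize detExcess ω ξ = E at *
  have hpa := mul_nonneg m0 (mul_self_nonneg a)
  have hqb := mul_nonneg m1 (mul_self_nonneg b)
  have hoff : |p * a + q * b| ≤ p * (a * a) + q * (b * b) + p + q := by
    rw [abs_le]
    constructor <;>
      nlinarith [mul_nonneg m0 (sq_nonneg (a + 1)), mul_nonneg m1 (sq_nonneg (b + 1)),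
        mul_nonneg m0 (sq_nonneg (a - 1)), mul_nonneg m1 (sq_nonneg (b - 1))]
  have hoff' := mul_le_mul_of_nonneg_left hoff hα.le
  have e1 := mul_nonneg hα.le hpa
  have e2 := mul_nonneg hα.le hqb
  have e3 := mul_nonneg hα.le m0
  have e4 := mul_nonneg hα.le m1
  fin_cases j <;> fin_cases j' <;> simp
  · rw [abs_of_nonneg (by linarith)]
    nlinarith
  · rw [show -(q * b) + -(p * a) = -(p * a + q * b) by ring, abs_neg]
    nlinarith
  · rw [show -(q * b) + -(p * a) = -(p * a + q * b) by ring, abs_neg]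
    nlinarith
  · rw [abs_of_nonneg (by linarith)]
    nlinarith

lemma det_matrixSymbol_pos (ω : Fin 2 → ℝ) {α : ℝ} (hα : 0 < α) (ξ : Plane) :
    0 < (matrixSymbol ω α ξ).det :=
  (pow_pos hα 2).trans_le (sq_le_det_matrixSymbol ω hα ξ)

lemma inv_matrixSymbol_apply (ω : Fin 2 → ℝ) (α : ℝ) (j j' : Fin 2) (ξ : Plane) :
    (matrixSymbol ω α ξ)⁻¹ j j' =
      ((matrixSymbol ω α ξ).det)⁻¹ * (matrixSymbol ω α ξ).adjugate j j' := by
  rw [Matrix.inv_def, Ring.inverse_eq_inv', Matrix.smul_apply, smul_eq_mul]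

lemma measurable_det_matrixSymbol (ω : Fin 2 → ℝ) (α : ℝ) :
    Measurable fun ξ => (matrixSymbol ω α ξ).det := by
  have := measurable_matrixSymbol ω α
  simp only [Matrix.det_fin_two]
  fun_prop

lemma exists_hasFourier_inv (ω : Fin 2 → ℝ) {α : ℝ} (hα : 0 < α) (j j' : Fin 2) :
    ∃ T, HasFourier T (fun ξ => ((matrixSymbol ω α ξ)⁻¹ j j' : ℂ)) := by
  have hm : Measurable fun ξ => (matrixSymbol ω α ξ)⁻¹ j j' := by
    simp only [inv_matrixSymbol_apply]
    refine (measurable_det_matrixSymbol ω α).inv.mul ?_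
    have := measurable_matrixSymbol ω α
    simp only [Matrix.adjugate_fin_two]
    fin_cases j <;> fin_cases j' <;> simp <;> fun_prop
  obtain ⟨S, hS⟩ := exists_isFunction_of_bound (Complex.measurable_ofReal.comp hm) (C := α⁻¹)
    fun ξ => by
      have hd := det_matrixSymbol_pos ω hα ξ
      simp only [Function.comp_apply]
      rw [Complex.norm_real, inv_matrixSymbol_apply, norm_mul, norm_inv, Real.norm_of_nonneg hd.le,
        inv_mul_le_iff₀ hd, ← div_eq_mul_inv, le_div_iff₀ hα, mul_comm]
      exact abs_adjugate_matrixSymbol_le ω hα j j' ξ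
  exact hS.exists_hasFourier

lemma exists_hasFourier_inv_det (ω : Fin 2 → ℝ) {α : ℝ} (hα : 0 < α) :
    ∃ T, HasFourier T (fun ξ => (((matrixSymbol ω α ξ).det)⁻¹ : ℂ)) := by
  obtain ⟨S, hS⟩ := exists_isFunction_of_bound
    (Complex.measurable_ofReal.comp (measurable_det_matrixSymbol ω α).inv) (C := (α ^ 2)⁻¹)
    fun ξ => by
      have hd := det_matrixSymbol_pos ω hα ξ
      simp only [Function.comp_apply, Pi.inv_apply]
      rw [Complex.norm_real, norm_inv, Real.norm_of_nonneg hd.le]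
      exact inv_anti₀ (pow_pos hα 2) (sq_le_det_matrixSymbol ω hα ξ)
  obtain ⟨T, hT⟩ := hS.exists_hasFourier
  exact ⟨T, by simpa [Function.comp_def] using hT⟩

/-! ### The convolution identities -/

lemma isConv_det {ω : Fin 2 → ℝ} (hω : ∀ i, 0 < ω i) (α : ℝ) {T : 𝓢'(Plane, ℂ)}
    (hT : HasFourier T (fun ξ => ((matrixSymbol ω α ξ).det : ℂ))) :
    IsConv (detLeft ω α) (detRight ω α) T := by
  refine ⟨fun k ξ => ![(entrySymbol (ω k.1) α 0 0 ξ : ℂ), -(entrySymbol (ω k.1) α 0 1 ξ : ℂ)] k.2.2,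
    fun k ξ => ![(entrySymbol (ω k.2.1) α 1 1 ξ : ℂ), (entrySymbol (ω k.2.1) α 0 1 ξ : ℂ)] k.2.2,
    ?_, ?_, ?_⟩
  · rintro ⟨i, i', s⟩
    fin_cases s
    · exact hasFourier_gEntry (hω i) α 0 0
    · exact (hasFourier_gEntry (hω i) α 0 1).neg
  · rintro ⟨i, i', s⟩
    fin_cases s
    · exact hasFourier_gEntry (hω i') α 1 1
    · exact hasFourier_gEntry (hω i') α 0 1
  · convert hT using 2 with ξ
    rw [Matrix.det_fin_two]
    simp only [matrixSymbol, Matrix.of_apply, Fintype.sum_prod_type, Fin.sum_univ_two,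
      entrySymbol_comm _ _ 1 0]
    simp
    ring

lemma isConv_inv {ω : Fin 2 → ℝ} (hω : ∀ i, 0 < ω i) {α : ℝ} {T g₂ : 𝓢'(Plane, ℂ)}
    {j j' : Fin 2} (hg₂ : HasFourier g₂ (fun ξ => (((matrixSymbol ω α ξ).det)⁻¹ : ℂ)))
    (hT : HasFourier T (fun ξ => ((matrixSymbol ω α ξ)⁻¹ j j' : ℂ))) :
    IsConv (fun l : Fin 2 => if j = l then g₂ else 0) (fun l => gAdj ω α l j') T := by
  refine ⟨fun l ξ => if j = l then (((matrixSymbol ω α ξ).det)⁻¹ : ℂ) else 0, _, fun l => ?_,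
    fun l => hasFourier_gAdj hω α l j', ?_⟩
  · dsimp only
    split_ifs
    · exact hg₂
    · exact hasFourier_zero
  · simpa [inv_matrixSymbol_apply] using hT

lemma isConv_det_inv {ω : Fin 2 → ℝ} {α : ℝ} (hα : 0 < α) {gde g₂ : 𝓢'(Plane, ℂ)}
    (hgde : HasFourier gde (fun ξ => ((matrixSymbol ω α ξ).det : ℂ)))
    (hg₂ : HasFourier g₂ (fun ξ => (((matrixSymbol ω α ξ).det)⁻¹ : ℂ))) :
    IsConv (fun _ : Unit => g₂) (fun _ : Unit => gde) diracZero := by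
  refine ⟨_, _, fun _ => hg₂, fun _ => hgde, ?_⟩
  convert hasFourier_diracZero using 2 with ξ
  have : ((matrixSymbol ω α ξ).det : ℂ) ≠ 0 :=
    Complex.ofReal_ne_zero.2 (det_matrixSymbol_pos ω hα ξ).ne'
  simp [this]

lemma inv_matrixSymbol_mul_apply (ω : Fin 2 → ℝ) {α : ℝ} (hα : 0 < α) (ξ : Plane)
    (v : Fin 2 → ℂ) (j : Fin 2) :
    ∑ k, ((matrixSymbol ω α ξ)⁻¹ j k : ℂ) * ∑ l, (matrixSymbol ω α ξ k l : ℂ) * v l = v j := by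
  have hdet : IsUnit (matrixSymbol ω α ξ).det :=
    isUnit_iff_ne_zero.2 (det_matrixSymbol_pos ω hα ξ).ne'
  have h : ∀ l, ∑ k, ((matrixSymbol ω α ξ)⁻¹ j k : ℂ) * (matrixSymbol ω α ξ k l : ℂ) =
      if j = l then 1 else 0 := by
    intro l
    have := congrFun (congrFun (Matrix.nonsing_inv_mul _ hdet) j) l
    rw [Matrix.mul_apply, Matrix.one_apply] at this
    simp only [← Complex.ofReal_mul, ← Complex.ofReal_sum]
    rw [this]
    split_ifs <;> simp
  calc _ = ∑ l, (∑ k, ((matrixSymbol ω α ξ)⁻¹ j k : ℂ) * (matrixSymbol ω α ξ k l : ℂ)) * v l := by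
        simp only [Finset.mul_sum, Finset.sum_mul, mul_assoc]
        exact Finset.sum_comm
    _ = v j := by simp [h]

/-- The distribution `𝐡` is a function, and its Fourier transform is the matrix symbol applied to
the Fourier transform of `𝐟`. -/
lemma exists_isFunction_normalPlane {ω : Fin 2 → ℝ} (hω : ∀ i, 0 < ω i) (α : ℝ) {R : ℝ}
    (f : L2BallPair R) (j : Fin 2) : ∃ T : 𝓢'(Plane, ℂ), IsFunction T (normalPlane ω α f j) ∧
      HasFourier T (fun ξ => ∑ l, (matrixSymbol ω α ξ j l : ℂ) * 𝓕 (zeroExt f l) ξ) := by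
  choose T hT hTF using fun i j' => exists_isFunction_fourierInv
    (integrable_specWeight_mul (hω i) j j' (continuous_fourier_zeroExt f j'))
  obtain ⟨S, hS⟩ := exists_isFunction_of_integrable (integrable_zeroExt f j)
  have hSF := hS.hasFourier_fourier (integrable_zeroExt f j)
  refine ⟨(∑ i, ∑ j', T i j') + (α : ℂ) • S, ?_, ?_⟩
  · have := (IsFunction.sum Finset.univ fun i => IsFunction.sum Finset.univ fun j' => hT i j').add
      (hS.smul (α : ℂ))
    convert this using 2 with y
    rw [normalPlane, adjointFormula_forwardOp hω]
  · have := (HasFourier.sum Finset.univ fun i => HasFourier.sum Finset.univ fun j' => hTF i j').add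
      (hSF.smul (α : ℂ))
    convert this using 2 with ξ
    fin_cases j <;> simp [matrixSymbol, entrySymbol, Fin.sum_univ_two] <;> ring

/-! ### Translation invariance -/

lemma memLp_zeroExt {R : ℝ} (f : L2BallPair R) (j : Fin 2) : MemLp (zeroExt f j) 2 volume :=
  (memLp_indicator_iff_restrict measurableSet_ball).2 (Lp.memLp (f j))

lemma memLp_zeroExt_sub_translate {R : ℝ} (f₁ f₂ : L2BallPair R) (a : Plane) (j : Fin 2) :
    MemLp (fun y => zeroExt f₂ j y - zeroExt f₁ j (y - a)) 2 volume :=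
  (memLp_zeroExt f₂ j).sub
    ((memLp_zeroExt f₁ j).comp_measurePreserving (measurePreserving_sub_right volume a))

/-- The difference of `f₂` and the translate of `f₁`, on a ball which contains the supports of
both. -/
def translateDiff {R : ℝ} (f₁ f₂ : L2BallPair R) (a : Plane) : L2BallPair (R + ‖a‖) :=
  WithLp.toLp 2 fun j => ((memLp_zeroExt_sub_translate f₁ f₂ a j).restrict _).toLp _

lemma zeroExt_translateDiff {R : ℝ} (f₁ f₂ : L2BallPair R) (a : Plane) (j : Fin 2) :
    ∀ᵐ y, zeroExt (translateDiff f₁ f₂ a) j y = zeroExt f₂ j y - zeroExt f₁ j (y - a) := by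
  have h := (ae_restrict_iff' measurableSet_ball).1
    ((memLp_zeroExt_sub_translate f₁ f₂ a j).restrict (Metric.ball 0 (R + ‖a‖))).coeFn_toLp
  filter_upwards [h] with y hy
  by_cases hmem : y ∈ Metric.ball (0 : Plane) (R + ‖a‖)
  · rw [← hy hmem, zeroExt, Set.indicator_of_mem hmem]
    rfl
  · rw [zeroExt, Set.indicator_of_notMem hmem]
    rw [mem_ball_zero_iff, not_lt] at hmem
    have h2 : y ∉ Metric.ball (0 : Plane) R := by
      rw [mem_ball_zero_iff, not_lt]
      linarith [norm_nonneg a]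
    have h1 : y - a ∉ Metric.ball (0 : Plane) R := by
      rw [mem_ball_zero_iff, not_lt]
      linarith [norm_sub_norm_le y a]
    rw [zeroExt, zeroExt, Set.indicator_of_notMem h2, Set.indicator_of_notMem h1, sub_zero]

lemma integrable_gFilter_mul (ω : ℝ) (j j' : Fin 2) (y : Plane) {f : Plane → ℂ}
    (hf : Integrable f) : Integrable fun z => (gFilter ω j j' (y - z) : ℂ) * f z := by
  have hm : MemLp (fun z => (gFilter ω j j' (y - z) : ℂ)) ∞ (volume : Measure Plane) :=
    (memLp_gFilter ω j j').comp_measurePreserving (Measure.measurePreserving_sub_left volume y)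
  exact hf.mul_of_top_right hm

lemma normalPlane_translateDiff {ω : Fin 2 → ℝ} (hω : ∀ i, 0 < ω i) (α : ℝ) {R : ℝ}
    (f₁ f₂ : L2BallPair R) (a : Plane) (j : Fin 2) :
    ∀ᵐ y, normalPlane ω α (translateDiff f₁ f₂ a) j y =
      normalPlane ω α f₂ j y - normalPlane ω α f₁ j (y - a) := by
  filter_upwards [ae_all_iff.2 (zeroExt_translateDiff f₁ f₂ a)] with y hy
  simp only [normalPlane_eq_conv hω, ← Finset.sum_sub_distrib]
  refine Finset.sum_congr rfl fun i _ => Finset.sum_congr rfl fun j' _ => ?_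
  have h1 : ∫ z, (gFilter (ω i) j j' (y - z) : ℂ) * zeroExt (translateDiff f₁ f₂ a) j' z =
      (∫ z, (gFilter (ω i) j j' (y - z) : ℂ) * zeroExt f₂ j' z) -
        ∫ z, (gFilter (ω i) j j' (y - a - z) : ℂ) * zeroExt f₁ j' z := by
    rw [← integral_sub_right_eq_self (fun z => (gFilter (ω i) j j' (y - a - z) : ℂ) *
      zeroExt f₁ j' z) a, ← integral_sub (integrable_gFilter_mul _ _ _ _ (integrable_zeroExt f₂ j'))]
    · refine integral_congr_ae ?_
      filter_upwards [zeroExt_translateDiff f₁ f₂ a j'] with z hz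
      rw [hz, sub_sub_sub_cancel_right, mul_sub]
    · simp only [sub_sub_sub_cancel_right]
      exact integrable_gFilter_mul _ _ _ _ ((integrable_zeroExt f₁ j').comp_sub_right a)
  rw [h1, hy]
  split_ifs <;> ring

/-- The map `𝐟 ↦ 𝐡` is injective, because `F*F + αI` is invertible. -/
lemma zeroExt_ae_eq_zero_iff {ω : Fin 2 → ℝ} (hω : ∀ i, 0 < ω i) {α : ℝ} (hα : 0 < α) {R : ℝ}
    (f : L2BallPair R) : (∀ j, ∀ᵐ y, zeroExt f j y = 0) ↔
      ∀ j, ∀ᵐ y, normalPlane ω α f j y = 0 := by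
  constructor
  · intro h j
    filter_upwards [ae_all_iff.2 h] with y hy
    rw [normalPlane_eq_conv hω]
    refine Finset.sum_eq_zero fun i _ => Finset.sum_eq_zero fun j' _ => ?_
    rw [hy, mul_zero, ite_self, add_zero]
    refine integral_eq_zero_of_ae ?_
    filter_upwards [h j'] with z hz
    rw [hz, mul_zero, Pi.zero_apply]
  · intro h
    have h0 : normalOp ω α R f = 0 := by
      refine PiLp.ext fun j => Lp.ext ?_
      filter_upwards [normalOp_coeFn ω α R f j, ae_restrict_of_ae (h j),
        Lp.coeFn_zero ℂ 2 (ballMeasure R)] with y h1 h2 h3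
      rw [h1, h2]
      exact h3.symm
    have hf : f = 0 := by
      have := ((ContinuousLinearMap.isUnit_iff_bijective).1 (isUnit_normalOp ω hα R)).1
      exact this (h0.trans (map_zero _).symm)
    intro j
    have h3 := (ae_restrict_iff' measurableSet_ball).1 (Lp.coeFn_zero ℂ 2 (ballMeasure R))
    filter_upwards [h3] with y hy
    rw [hf, zeroExt]
    by_cases hm : y ∈ Metric.ball (0 : Plane) R
    · rw [Set.indicator_of_mem hm]
      exact hy hm
    · rw [Set.indicator_of_notMem hm]

lemma translation_iff {ω : Fin 2 → ℝ} (hω : ∀ i, 0 < ω i) {α : ℝ} (hα : 0 < α) {R : ℝ}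
    (f₁ f₂ : L2BallPair R) (a : Plane) :
    (∀ j, ∀ᵐ y, zeroExt f₂ j y = zeroExt f₁ j (y - a)) ↔
      (∀ j, ∀ᵐ y, normalPlane ω α f₂ j y = normalPlane ω α f₁ j (y - a)) := by
  have h := zeroExt_ae_eq_zero_iff hω hα (translateDiff f₁ f₂ a)
  have h1 : ∀ j, (∀ᵐ y, zeroExt (translateDiff f₁ f₂ a) j y = 0) ↔
      ∀ᵐ y, zeroExt f₂ j y = zeroExt f₁ j (y - a) := fun j =>
    Filter.eventually_congr ((zeroExt_translateDiff f₁ f₂ a j).mono fun y hy => by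
      rw [hy, sub_eq_zero])
  have h2 : ∀ j, (∀ᵐ y, normalPlane ω α (translateDiff f₁ f₂ a) j y = 0) ↔
      ∀ᵐ y, normalPlane ω α f₂ j y = normalPlane ω α f₁ j (y - a) := fun j =>
    Filter.eventually_congr ((normalPlane_translateDiff hω α f₁ f₂ a j).mono fun y hy => by
      rw [hy, sub_eq_zero])
  simpa only [h1, h2] using h

end

theorem mainTheorem3 (ω : Fin 2 → ℝ) (hω₀ : 0 < ω 0) (hω₁ : ω 0 < ω 1) (α : ℝ) (hα : 0 < α) :
    -- the filters are radially symmetric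
    (∀ (i j j' : Fin 2) (y y' : Plane), ‖y‖ = ‖y'‖ →
      gFilter (ω i) j j' y = gFilter (ω i) j j' y') ∧
    -- `G = 𝓕(𝐠)`, `K = 𝓕⁻¹(𝓕(𝐠)⁻¹)`, and the scalar kernels `g_de` and `g₂`
    ∃ (G : Plane → Matrix (Fin 2) (Fin 2) ℝ) (K : Fin 2 → Fin 2 → 𝓢'(Plane, ℂ))
      (gde g₂ : 𝓢'(Plane, ℂ)),
      (∀ j j', HasFourier (gKernel ω α j j') (fun ξ => (G ξ j j' : ℂ))) ∧
      (∀ᵐ ξ, (G ξ).IsSymm) ∧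
      (∀ᵐ ξ, α ^ 2 ≤ (G ξ).det) ∧
      (∀ j j', HasFourier (K j j') (fun ξ => ((G ξ)⁻¹ j j' : ℂ))) ∧
      IsConv (detLeft ω α) (detRight ω α) gde ∧
      HasFourier gde (fun ξ => ((G ξ).det : ℂ)) ∧
      HasFourier g₂ (fun ξ => (((G ξ).det)⁻¹ : ℂ)) ∧
      IsConv (fun _ : Unit => g₂) (fun _ : Unit => gde) diracZero ∧
      -- `K = (g₂ I₂) * adj`
      (∀ j j', IsConv (fun l : Fin 2 => if j = l then g₂ else 0) (fun l => gAdj ω α l j')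
        (K j j')) ∧
      ∀ R : ℝ, 0 < R →
        -- the explicit formula for `F*` on the ball, and invertibility of `F*F + αI`
        (∀ (Λ : L2DataPair) (j : Fin 2), ∀ᵐ y ∂(ballMeasure R),
          ContinuousLinearMap.adjoint (forwardOp ω R) Λ j y = adjointFormula ω Λ j y) ∧
        IsUnit (normalOp ω α R) ∧
        (∀ f : L2BallPair R,
          -- `𝐡 = (F*F + αI) 𝐟 = 𝐠 * 𝐟`
          (∀ j, ∀ᵐ y ∂(ballMeasure R), normalOp ω α R f j y = normalPlane ω α f j y) ∧
          (∀ j y, normalPlane ω α f j y =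
            ∑ i, ∑ j', ((∫ z, (gFilter (ω i) j j' (y - z) : ℂ) * zeroExt f j' z) +
              if j = j' then ((α / 2 : ℝ) : ℂ) * zeroExt f j' y else 0)) ∧
          -- the same as tempered distributions, and `(F*F + αI)⁻¹ 𝐡 = K * 𝐡`
          ∃ f' h' u' : Fin 2 → 𝓢'(Plane, ℂ),
            (∀ j, IsFunction (f' j) (zeroExt f j)) ∧
            (∀ j, IsFunction (h' j) (normalPlane ω α f j)) ∧
            (∀ j, IsFunction (u' j)
              (zeroExt (Ring.inverse (normalOp ω α R) (normalOp ω α R f)) j)) ∧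
            (∀ j, IsConv (gKernel ω α j) f' (h' j)) ∧
            (∀ j, IsConv (K j) h' (u' j))) ∧
        -- translation invariance of `𝐟 ↦ 𝐡` and of its inverse `𝐡 ↦ 𝐟`
        (∀ (f₁ f₂ : L2BallPair R) (a : Plane),
          (∀ j, ∀ᵐ y, zeroExt f₂ j y = zeroExt f₁ j (y - a)) ↔
            (∀ j, ∀ᵐ y, normalPlane ω α f₂ j y = normalPlane ω α f₁ j (y - a))) := by

  have hω : ∀ i, 0 < ω i := Fin.forall_fin_two.2 ⟨hω₀, hω₀.trans hω₁⟩
  obtain ⟨gde, hgde⟩ := exists_hasFourier_det hω₀ hω₁ α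
  obtain ⟨g₂, hg₂⟩ := exists_hasFourier_inv_det ω hα
  choose K hK using exists_hasFourier_inv ω hα
  refine ⟨fun i j j' y y' h => gFilter_radial (ω i) j j' h, matrixSymbol ω α, K, gde, g₂,
    hasFourier_gKernel hω α, Filter.Eventually.of_forall (matrixSymbol_isSymm ω α),
    Filter.Eventually.of_forall (sq_le_det_matrixSymbol ω hα), hK, isConv_det hω α hgde, hgde, hg₂,
    isConv_det_inv hα hgde hg₂, fun j j' => isConv_inv hω hg₂ (hK j j'), fun R _ => ?_⟩
  refine ⟨adjoint_forwardOp_coeFn ω R, isUnit_normalOp ω hα R, fun f =>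
    ⟨normalOp_coeFn ω α R f, normalPlane_eq_conv hω α f, ?_⟩, fun f₁ f₂ a =>
      translation_iff hω hα f₁ f₂ a⟩
  choose f' hf' using fun j => exists_isFunction_of_integrable (integrable_zeroExt f j)
  have hf'F : ∀ j, HasFourier (f' j) (𝓕 (zeroExt f j)) := fun j =>
    (hf' j).hasFourier_fourier (integrable_zeroExt f j)
  choose h' hh' hh'F using exists_isFunction_normalPlane hω α f
  have hinv : Ring.inverse (normalOp ω α R) (normalOp ω α R f) = f :=
    congrArg (fun T : L2BallPair R →L[ℂ] L2BallPair R => T f)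
      (Ring.inverse_mul_cancel _ (isUnit_normalOp ω hα R))
  -- The distribution of the recovered pair is that of `𝐟` itself.
  refine ⟨f', h', f', hf', hh', by rwa [hinv], fun j => ?_, fun j => ?_⟩
  · exact ⟨_, _, fun k => hasFourier_gKernel hω α j k, hf'F, hh'F j⟩
  · refine ⟨_, _, fun k => hK j k, hh'F, ?_⟩
    simpa only [inv_matrixSymbol_mul_apply ω hα] using hf'F j
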